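/- **Definitions.** For a set $X$ let $\mathbf W(X)$ be the free monoid of words in $X$, with concatenation $\circ$ and empty word $\emptyset$; elements of $X$ are identified with words of length $1$. A *partial group* is a non-empty set $\mathcal L$ with a set $\mathbf D=\mathbf D(\mathcal L)\subseteq\mathbf W(\mathcal L)$, a map $\Pi:\mathbf D\to\mathcal L$ and an involutory bijection $x\mapsto x^{-1}$ of $\mathcal L$, extended to words by $(x_1,\dots,x_n)^{-1}=(x_n^{-1},\dots,x_1^{-1})$, such that: (1) $\mathcal L\subseteq\mathbf D$, and $u\circ v\in\mathbf D$ implies $u,v\in\mathbf D$; (2) $\Pi$ is the identity on $\mathcal L$; (3) $u\circ v\circ w\in\mathbf D$ implies $u\circ(\Pi(v))\circ w\in\mathbf D$ and $\Pi(u\circ v\circ w)=\Pi(u\circ(\Pi(v))\circ w)$; (4) $w\in\mathbf D$ implies $w^{-1}\circ w\in\mathbf D$ and $\Pi(w^{-1}\circ w)=\mathbf 1$, where $\mathbf 1:=\Pi(\emptyset)$. For $g\in\mathcal L$ let $\mathbf D(g)=\{x\in\mathcal L\mid (g^{-1},x,g)\in\mathbf D\}$, and $x^g=\Pi(g^{-1},x,g)$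 for $x\in\mathbf D(g)$; "$X^g=Y$" means that $X\subseteq\mathbf D(g)$ and $Y=\{x^g\mid x\in X\}$. A *partial subgroup* of $\mathcal L$ is a non-empty subset $\mathcal H$ that is closed under inversion and satisfies $\Pi(w)\in\mathcal H$ for all $w\in\mathbf W(\mathcal H)\cap\mathbf D$. It is *normal* in $\mathcal L$, written $\mathcal H\trianglelefteq\mathcal L$, if $x^g\in\mathcal H$ whenever $x\in\mathcal H$, $g\in\mathcal L$ and $x\in\mathbf D(g)$. It is a *subgroup* if moreover $\mathbf W(\mathcal H)\subseteq\mathbf D$; a subgroup is a group under $\Pi$. A *$p$-subgroup* is a subgroup all of whose elements have order a power of $p$. A *pre-locality* $(\mathcal L,\Delta,S)$ is a partial group $\mathcal L$ with a set $\Delta$ of subgroups of $\mathcal L$ and a member $S$ of $\Delta$ that contains all members of $\Delta$, such that: (O1) a word $(g_1,\dots,g_n)$ is in $\mathbf D$ if and only if there are $X_0,\dots,X_n\in\Delta$ with $X_{i-1}^{g_i}=X_i$ for $1\le i\le n$; (O2) if $X,Y\in\Delta$, $g\in\mathcal L$ and $X^g$ is (defined and) a subgroup of $Y$, then every subgroup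 of $Y$ containing $X^g$ is in $\Delta$. For a word $w=(g_1,\dots,g_n)$ let $S_w$ be the set of all $x\in S$ for which $x_0=x$, $x_i=x_{i-1}^{g_i}$ $(1\le i\le n)$ are all defined and lie in $S$. For a subgroup $X\le S$ put $X^\star=\bigcap\{S_w\mid w\in\mathbf W(\mathcal L),\ X\le S_w\}$, and put $\Omega_S(\mathcal L)=\{X^\star\mid X\le S\}$, ordered by inclusion. A *locality* is a pre-locality $(\mathcal L,\Delta,S)$ such that the lengths of the chains in $\Omega_S(\mathcal L)$ are bounded, $S$ is maximal among the $p$-subgroups of $\mathcal L$ for some prime $p$, and each subgroup of $\mathcal L$ is countable and locally finite. A *homomorphism* $\beta:\mathcal L\to\mathcal L'$ of partial groups is a map whose induced map $\beta^*:\mathbf W(\mathcal L)\to\mathbf W(\mathcal L')$ sends $\mathbf D(\mathcal L)$ into $\mathbf D(\mathcal L')$ and satisfies $\beta(\Pi(w))=\Pi'(\beta^*(w))$ for $w\in\mathbf D(\mathcal L)$; its *kernel* is $\{g\in\mathcal L\mid\beta(g)=\mathbf 1'\}$. For localities $(\mathcal L,\Delta,S)$ and $(\mathcal L',\Delta',S')$,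 a homomorphism $\beta$ is a *projection* if $\beta^*(\mathbf D(\mathcal L))=\mathbf D(\mathcal L')$ and $\Delta'=\{\beta(P)\mid P\in\Delta\}$. **Proposition 5.7 (Partial Subgroup Correspondence).** Let $(\mathcal L,\Delta,S)$ and $(\bar{\mathcal L},\bar\Delta,\bar S)$ be localities, let $\beta:\mathcal L\to\bar{\mathcal L}$ be a projection, and set $\mathcal N=\operatorname{Ker}(\beta)$. Then $\mathcal H\mapsto\beta(\mathcal H)$ is a bijection from the set $\mathfrak H$ of partial subgroups $\mathcal H$ of $\mathcal L$ containing $\mathcal N$ onto the set $\bar{\mathfrak H}$ of partial subgroups of $\bar{\mathcal L}$. Moreover, for every $\mathcal H\in\mathfrak H$, we have $\beta(\mathcal H)\trianglelefteq\bar{\mathcal L}$ if and only if $\mathcal H\trianglelefteq\mathcal L$. -/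

import Mathlib

universe u v

/-- A partial group on `L`. Words are lists, and concatenation of words is `++`.

`D` is the set of words that have a product. The product is a map `D → L`; it is encoded by the
total function `prod`, no axiom and no later definition uses its values outside `D`. (The value
`prod []` shows that `L` is non-empty; then `[] ∈ D` follows from `singleton_mem` and
`mem_of_append_mem`.) -/
class PartialGroup (L : Type u) where
  /-- The words whose product is defined. -/
  D : Set (List L)
  /-- The product, meaningful on `D` only. -/
  prod : List L → L
  /-- The inversion. -/
  inv : L → L
  singleton_mem : ∀ x : L, [x] ∈ D
  mem_of_append_mem : ∀ u v : List L, u ++ v ∈ D → u ∈ D ∧ v ∈ D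
  prod_singleton : ∀ x : L, prod [x] = x
  contract_mem : ∀ u v w : List L, u ++ v ++ w ∈ D → u ++ [prod v] ++ w ∈ D
  prod_contract : ∀ u v w : List L, u ++ v ++ w ∈ D →
    prod (u ++ v ++ w) = prod (u ++ [prod v] ++ w)
  inv_inv : ∀ x : L, inv (inv x) = x
  inv_append_mem : ∀ w : List L, w ∈ D → (w.map inv).reverse ++ w ∈ D
  prod_inv_append : ∀ w : List L, w ∈ D → prod ((w.map inv).reverse ++ w) = prod []

namespace PartialGroup

section Basic

variable {L : Type u} [PartialGroup L]

/-- The identity element: the product of the empty word. -/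
def one (L : Type u) [PartialGroup L] : L := prod ([] : List L)

/-- The set of all `x` for which the conjugate `x ^ g` is defined. -/
def conjDom (g : L) : Set L := {x | [inv g, x, g] ∈ D}

/-- The conjugate `x ^ g`, meaningful for `x ∈ conjDom g` only. -/
def conj (x g : L) : L := prod [inv g, x, g]

/-- `X ^ g = Y`: the set `X` can be conjugated by `g`, and the result is `Y`. -/
def ConjEq (X : Set L) (g : L) (Y : Set L) : Prop :=
  X ⊆ conjDom g ∧ (fun x => conj x g) '' X = Y

/-- Partial subgroups. -/
structure IsPartialSubgroup (H : Set L) : Prop where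
  nonempty : H.Nonempty
  inv_mem : ∀ x ∈ H, inv x ∈ H
  prod_mem : ∀ w : List L, (∀ x ∈ w, x ∈ H) → w ∈ D → prod w ∈ H

/-- Partial normal subgroups. -/
structure IsPartialNormal (N : Set L) : Prop where
  isPartialSubgroup : IsPartialSubgroup N
  conj_mem : ∀ x ∈ N, ∀ g : L, x ∈ conjDom g → conj x g ∈ N

/-- Subgroups: partial subgroups `H` in which every word in the elements of `H` has a product. -/
structure IsSubgroup (H : Set L) : Prop where
  isPartialSubgroup : IsPartialSubgroup H
  word_mem : ∀ w : List L, (∀ x ∈ w, x ∈ H) → w ∈ D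

/-- `ConjChain Δ X (g₁, …, gₙ)`: there are `X = X₀, X₁, …, Xₙ` in `Δ` such that
`Xᵢ₋₁ ^ gᵢ = Xᵢ` for all `i`. -/
def ConjChain (Δ : Set (Set L)) : Set L → List L → Prop
  | X, [] => X ∈ Δ
  | X, g :: w => X ∈ Δ ∧ ∃ Y, ConjEq X g Y ∧ ConjChain Δ Y w

/-- `(L, Δ)` is an objective partial group. -/
structure IsObjective (Δ : Set (Set L)) : Prop where
  isSubgroup : ∀ X ∈ Δ, IsSubgroup X
  mem_D_iff : ∀ w : List L, w ∈ D ↔ ∃ X, ConjChain Δ X w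
  overgroup_mem : ∀ X ∈ Δ, ∀ Y ∈ Δ, ∀ (g : L) (X' : Set L),
    ConjEq X g X' → IsSubgroup X' → X' ⊆ Y →
    ∀ Z : Set L, IsSubgroup Z → X' ⊆ Z → Z ⊆ Y → Z ∈ Δ

/-- `(L, Δ, S)` is a pre-locality. -/
structure IsPreLocality (Δ : Set (Set L)) (S : Set L) : Prop where
  isObjective : IsObjective Δ
  top_mem : S ∈ Δ
  subset_top : ∀ X ∈ Δ, X ⊆ S

/-- The set `S_w` of all elements of `S` that are conjugated successively into `S` by the entries
of the word `w`. -/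
def conjInto (S : Set L) : List L → Set L
  | [] => S
  | g :: w => {x | x ∈ S ∧ x ∈ conjDom g ∧ conj x g ∈ conjInto S w}

/-- `X ^ ⋆`, the intersection of all the `S_w` that contain `X`. -/
def star (S X : Set L) : Set L := ⋂ w ∈ {w : List L | X ⊆ conjInto S w}, conjInto S w

/-- The poset `Ω_S(L) = {X ^ ⋆ | X ≤ S}`, ordered by inclusion. -/
def Omega (S : Set L) : Set (Set L) := {Y | ∃ X, IsSubgroup X ∧ X ⊆ S ∧ Y = star S X}

/-- `Ω_S(L)` has finite dimension: the lengths of its chains are bounded. -/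
def FiniteDim (S : Set L) : Prop := Order.krullDim (Omega S) < ⊤

/-- Subgroups of a partial group all of whose elements have order a power of `p`. -/
structure IsPSubgroup (p : ℕ) (H : Set L) : Prop where
  isSubgroup : IsSubgroup H
  pow_eq_one : ∀ x ∈ H, ∃ k : ℕ, prod (List.replicate (p ^ k) x) = one L

/-- Every finite subset of `H` lies in a finite subgroup of `H`. -/
def LocallyFiniteIn (H : Set L) : Prop :=
  ∀ F : Set L, F.Finite → F ⊆ H → ∃ K : Set L, IsSubgroup K ∧ K.Finite ∧ F ⊆ K ∧ K ⊆ H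

/-- `(L, Δ, S)` is a locality. -/
structure IsLocality (Δ : Set (Set L)) (S : Set L) : Prop where
  isPreLocality : IsPreLocality Δ S
  finiteDim : FiniteDim S
  maximal_pSubgroup : ∃ p : ℕ, p.Prime ∧ Maximal (IsPSubgroup p) S
  locallyFinite : ∀ H : Set L, IsSubgroup H → LocallyFiniteIn H
  countable : ∀ H : Set L, IsSubgroup H → H.Countable

end Basic

section Hom

variable {L : Type u} {L' : Type v} [PartialGroup L] [PartialGroup L']

/-- Homomorphisms of partial groups. -/
structure IsHom (β : L → L') : Prop where
  map_mem : ∀ w : List L, w ∈ D → w.map β ∈ D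
  map_prod : ∀ w : List L, w ∈ D → β (prod w) = prod (w.map β)

/-- The kernel of a map into a partial group. -/
def ker (β : L → L') : Set L := {g | β g = one L'}

/-- `β` is a projection from the locality with set of objects `Δ` to the locality with set of
objects `Δ'`. -/
structure IsProjection (Δ : Set (Set L)) (Δ' : Set (Set L')) (β : L → L') : Prop where
  isHom : IsHom β
  image_D : List.map β '' (D : Set (List L)) = (D : Set (List L'))
  image_objects : Δ' = {Q | ∃ P ∈ Δ, Q = β '' P}

end Hom

end PartialGroup

/-! The heart is `preimage_image`: a partial subgroup H containing the kernel is a union of fibres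
of β. In a group, β g = β h puts g⁻¹h in the kernel, but here (g⁻¹, h) may have no product. The
remedy is `exists_lift`: each g' in the image has a lift f such that S_f contains every x ∈ S with β
x ∈ S'_{g'}. Hence S_g ⊆ S_f for every g over g'. Both g and f then conjugate the object S_g to
objects, so g⁻¹f is defined and lies in the kernel, and g ∈ H iff f ∈ H.

To find f, take a lift h of g' for which S_h has maximal rank, the rank of X being the height of X^⋆
in Ω_S(L). If S_h is smaller than P = S ∩ β⁻¹(S'_{g'}), some y ∈ P outside S_h normalizes S_h
(`exists_moves_notMem`). Then y^h is a p-element normalizing the object (S_h)^h, with image in S'. A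
Sylow-type argument inside M = β⁻¹(S') (`exists_moves_conj_mem`) gives g ∈ M with (y^h)^g ∈ S. With
s ∈ S and β s = β g, the element h g s⁻¹ is again a lift of g', and its domain contains S_h and y,
against maximality.

Since S may be infinite, normalizers need not grow in it in general. But every ⋆-closure is the
closure of a finite set (`exists_finite_star_eq`), and with local finiteness this reduces the
normalizer and Sylow arguments to finite groups.

Normality of β(H) pulls back because H is a full preimage. Conversely, `exists_mem_conjDom` lifts
any conjugate defined in the image, using the lifts above. -/

namespace PartialGroup

/-! ### Word calculus in partial groups; subgroups as groups. -/

section Words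

variable {L : Type u} [PartialGroup L]

/-- The binary product, meaningful if `[a, b] ∈ D`. -/
def mul (a b : L) : L := prod [a, b]

/-- The inverse of a word. -/
def invWord (w : List L) : List L := (w.map inv).reverse

theorem invWord_append (u v : List L) : invWord (u ++ v) = invWord v ++ invWord u := by
  simp [invWord]

theorem invWord_invWord (w : List L) : invWord (invWord w) = w := by
  simp [invWord, List.map_reverse, Function.comp_def, inv_inv]

theorem nil_mem : ([] : List L) ∈ D :=
  (mem_of_append_mem [] [one L] (singleton_mem _)).1

theorem mem_left {u v : List L} (h : u ++ v ∈ D) : u ∈ D := (mem_of_append_mem u v h).1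

theorem mem_right {u v : List L} (h : u ++ v ∈ D) : v ∈ D := (mem_of_append_mem u v h).2

theorem invWord_append_mem {w : List L} (h : w ∈ D) : invWord w ++ w ∈ D := inv_append_mem w h

theorem invWord_mem {w : List L} (h : w ∈ D) : invWord w ∈ D := mem_left (invWord_append_mem h)

theorem append_invWord_mem {w : List L} (h : w ∈ D) : w ++ invWord w ∈ D := by
  simpa [invWord_invWord] using invWord_append_mem (invWord_mem h)

theorem prod_append_invWord {w : List L} (h : w ∈ D) : prod (w ++ invWord w) = one L := by
  have := prod_inv_append (invWord w) (invWord_mem h)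
  change prod (invWord (invWord w) ++ invWord w) = _ at this
  rwa [invWord_invWord] at this

theorem prod_invWord_append {w : List L} (h : w ∈ D) : prod (invWord w ++ w) = one L :=
  prod_inv_append w h

theorem invWord_append_append_mem {u v : List L} (h : u ++ v ∈ D) : invWord u ++ (u ++ v) ∈ D := by
  have := invWord_append_mem h
  rw [invWord_append, List.append_assoc] at this
  exact mem_right this

theorem append_append_invWord_mem {u v : List L} (h : u ++ v ∈ D) : u ++ v ++ invWord v ∈ D := by
  have := append_invWord_mem h
  rw [invWord_append, ← List.append_assoc] at this
  exact mem_left this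

theorem prod_append_left {u v : List L} (h : u ++ v ∈ D) : prod (u ++ v) = prod (prod u :: v) := by
  simpa using prod_contract [] u v (by simpa using h)

theorem prod_append_right {u v : List L} (h : u ++ v ∈ D) :
    prod (u ++ v) = prod (u ++ [prod v]) := by
  simpa using prod_contract u v [] (by simpa using h)

theorem mul_one_eq (a : L) : mul a (one L) = a := by
  have := prod_contract [a] [] [] (by simpa using singleton_mem a)
  simpa [mul, one, prod_singleton] using this.symm

theorem one_mul_eq (a : L) : mul (one L) a = a := by
  have := prod_contract [] [] [a] (by simpa using singleton_mem a)
  simpa [mul, one, prod_singleton] using this.symm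

theorem append_mem_of_one {u w : List L} (h : u ++ one L :: w ∈ D) : u ++ w ∈ D := by
  rcases List.eq_nil_or_concat' u with rfl | ⟨u, a, rfl⟩
  · exact mem_right (u := [one L]) (by simpa using h)
  -- A contraction can only replace a subword by its product, so the identity is absorbed into the
  -- letter before it.
  · have := contract_mem u [a, one L] w (by simpa using h)
    have e : prod [a, one L] = a := mul_one_eq a
    simpa [e] using this

theorem prod_append_one {u w : List L} (h : u ++ w ∈ D) :
    prod (u ++ one L :: w) = prod (u ++ w) := by
  have := prod_contract u [] w (by simpa using h)
  simpa [one] using this.symm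

theorem cancel {u w : List L} {a : L} (h : u ++ a :: inv a :: w ∈ D) :
    u ++ w ∈ D ∧ prod (u ++ a :: inv a :: w) = prod (u ++ w) := by
  have e : prod [a, inv a] = one L := prod_append_invWord (w := [a]) (singleton_mem a)
  have h1 := contract_mem u [a, inv a] w (by simpa using h)
  have h2 := prod_contract u [a, inv a] w (by simpa using h)
  rw [e] at h1 h2
  simp only [List.append_assoc, List.cons_append, List.nil_append] at h1 h2
  have h3 := append_mem_of_one h1
  exact ⟨h3, h2.trans (prod_append_one h3)⟩

theorem eq_inv_of_mul_eq_one {a b : L} (h : [a, b] ∈ D) (e : mul a b = one L) : a = inv b := by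
  have h1 : [a, b, inv b] ∈ D := append_append_invWord_mem (u := [a]) (v := [b]) h
  have h2 := (cancel (u := [a]) (w := []) h1).2
  have h3 := prod_append_left (u := [a, b]) (v := [inv b]) h1
  change _ = prod [mul a b, inv b] at h3
  rw [e] at h3
  change _ = mul (one L) (inv b) at h3
  rw [one_mul_eq] at h3
  simp only [List.cons_append, List.nil_append, prod_singleton] at h2 h3
  exact h2.symm.trans h3

theorem prod_invWord {w : List L} (h : w ∈ D) : prod (invWord w) = inv (prod w) := by
  have h0 := invWord_append_mem h
  have h1 := contract_mem [] (invWord w) w h0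
  have h2 := contract_mem [prod (invWord w)] w [] (by simpa using h1)
  refine eq_inv_of_mul_eq_one (by simpa using h2) ?_
  rw [← prod_invWord_append h, prod_append_left h0]
  simpa [mul] using (prod_append_right (u := [prod (invWord w)]) (v := w) (by simpa using h1)).symm

theorem inv_mul_eq {a b : L} (h : [a, b] ∈ D) : inv (mul a b) = mul (inv b) (inv a) :=
  (prod_invWord h).symm

theorem prod_cons {a : L} {w : List L} (h : a :: w ∈ D) : prod (a :: w) = mul a (prod w) :=
  prod_append_right (u := [a]) (v := w) h

theorem mul_inv_self (a : L) : mul a (inv a) = one L :=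
  prod_append_invWord (w := [a]) (singleton_mem a)

theorem inv_mul_self (a : L) : mul (inv a) a = one L :=
  prod_invWord_append (w := [a]) (singleton_mem a)

theorem mul_mul_eq {a b c : L} (h : [a, b, c] ∈ D) : mul (mul a b) c = mul a (mul b c) := by
  have h1 := prod_append_left (u := [a, b]) (v := [c]) h
  have h2 := prod_append_right (u := [a]) (v := [b, c]) h
  exact h1.symm.trans h2

/-- The word (g⁻¹, x, g) extends to (g, g⁻¹, x, g, g⁻¹) in `D`. Contracting its middle gives the
iterated conjugate, and cancelling both ends gives x. -/
theorem conj_conj_inv {x g : L} (h : x ∈ conjDom g) :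
    conj x g ∈ conjDom (inv g) ∧ conj (conj x g) (inv g) = x := by
  have h1 : [g, inv g, x, g] ∈ D := by
    simpa [invWord, inv_inv] using
      invWord_append_append_mem (u := [inv g]) (v := [x, g]) (show _ ∈ D from h)
  have h2 : [g, inv g, x, g, inv g] ∈ D :=
    append_append_invWord_mem (u := [g, inv g, x]) (v := [g]) h1
  have h3 := contract_mem [g] [inv g, x, g] [inv g] h2
  have h4 := prod_contract [g] [inv g, x, g] [inv g] h2
  obtain ⟨h5, h6⟩ := cancel (u := []) (w := [x, g, inv g]) h2
  obtain ⟨-, h7⟩ := cancel (u := [x]) (w := []) h5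
  constructor
  · simpa [conjDom, conj, inv_inv] using h3
  · have : conj (conj x g) (inv g) = prod ([g] ++ [prod [inv g, x, g]] ++ [inv g]) := by
      simp [conj, inv_inv]
    rw [this, ← h4]
    exact h6.trans (h7.trans (prod_singleton x))

theorem conj_inv_conj {x g : L} (h : x ∈ conjDom (inv g)) :
    conj x (inv g) ∈ conjDom g ∧ conj (conj x (inv g)) g = x := by
  simpa [inv_inv] using conj_conj_inv h

theorem conj_inv {x g : L} (h : x ∈ conjDom g) :
    inv x ∈ conjDom g ∧ conj (inv x) g = inv (conj x g) := by
  have h0 : [inv g, x, g] ∈ D := h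
  have h1 := invWord_mem h0
  have h2 := prod_invWord h0
  simp only [invWord, List.map_cons, List.map_nil, inv_inv, List.reverse_cons, List.reverse_nil,
    List.nil_append, List.cons_append] at h1 h2
  exact ⟨h1, h2⟩

theorem conj_mul {x g h : L} (hw : [inv h, inv g, x, g, h] ∈ D) :
    x ∈ conjDom (mul g h) ∧ conj x (mul g h) = conj (conj x g) h := by
  have hgh : [g, h] ∈ D := mem_right (u := [inv h, inv g, x]) hw
  have h1 := contract_mem [inv h, inv g, x] [g, h] [] hw
  have h2 := prod_contract [inv h, inv g, x] [g, h] [] hw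
  have h3 := contract_mem [] [inv h, inv g] [x, mul g h] h1
  have h4 := prod_contract [] [inv h, inv g] [x, mul g h] h1
  have h5 := prod_contract [inv h] [inv g, x, g] [h] hw
  have e : prod [inv h, inv g] = inv (mul g h) := (inv_mul_eq hgh).symm
  rw [e] at h3 h4
  exact ⟨h3, h4.symm.trans (h2.symm.trans h5)⟩

theorem mul_conj {a b g : L} (hw : [inv g, a, g, inv g, b, g] ∈ D) :
    mul a b ∈ conjDom g ∧ [conj a g, conj b g] ∈ D ∧
      conj (mul a b) g = mul (conj a g) (conj b g) := by
  obtain ⟨h1, h2⟩ := cancel (u := [inv g, a]) (w := [b, g]) hw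
  have h3 := contract_mem [inv g] [a, b] [g] h1
  have h4 := prod_contract [inv g] [a, b] [g] h1
  have h5 := contract_mem [] [inv g, a, g] [inv g, b, g] hw
  have h6 := contract_mem [conj a g] [inv g, b, g] [] h5
  have h7 := prod_contract [] [inv g, a, g] [inv g, b, g] hw
  have h8 := prod_contract [conj a g] [inv g, b, g] [] h5
  exact ⟨h3, h6, h4.symm.trans (h2.symm.trans (h7.trans h8))⟩

theorem conj_one {g : L} : one L ∈ conjDom g ∧ conj (one L) g = one L := by
  have h1 : [inv g, g] ∈ D := invWord_append_mem (w := [g]) (singleton_mem g)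
  have h2 := contract_mem [inv g] [] [g] h1
  have h3 := prod_contract [inv g] [] [g] h1
  exact ⟨h2, h3.symm.trans (inv_mul_self g)⟩

/-- The set of conjugates of the elements of `X` by `g`. -/
def conjSet (X : Set L) (g : L) : Set L := (fun x => conj x g) '' X

theorem conjEq_conjSet {X : Set L} {g : L} (h : X ⊆ conjDom g) : ConjEq X g (conjSet X g) := ⟨h, rfl⟩

theorem ConjEq.eq {X Y : Set L} {g : L} (h : ConjEq X g Y) : Y = conjSet X g := h.2.symm

theorem ConjEq.mem {X Y : Set L} {g x : L} (h : ConjEq X g Y) (hx : x ∈ X) : conj x g ∈ Y :=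
  h.2 ▸ ⟨x, hx, rfl⟩

theorem ConjEq.symm {X Y : Set L} {g : L} (h : ConjEq X g Y) : ConjEq Y (inv g) X := by
  obtain ⟨h1, rfl⟩ := h
  constructor
  · rintro _ ⟨x, hx, rfl⟩
    exact (conj_conj_inv (h1 hx)).1
  · ext y
    constructor
    · rintro ⟨_, ⟨x, hx, rfl⟩, rfl⟩
      have := (conj_conj_inv (h1 hx)).2
      simp only [this]
      exact hx
    · intro hy
      exact ⟨_, ⟨y, hy, rfl⟩, (conj_conj_inv (h1 hy)).2⟩

theorem conj_injOn (g : L) : Set.InjOn (fun x : L => conj x g) (conjDom g) := by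
  intro x hx y hy e
  have := (conj_conj_inv hx).2
  simp only at e
  rw [e, (conj_conj_inv hy).2] at this
  exact this.symm

theorem IsPartialSubgroup.one_mem {H : Set L} (h : IsPartialSubgroup H) : one L ∈ H :=
  h.prod_mem [] (by simp) nil_mem

theorem IsPartialSubgroup.mul_mem {H : Set L} (h : IsPartialSubgroup H) {a b : L} (ha : a ∈ H)
    (hb : b ∈ H) (hab : [a, b] ∈ D) : mul a b ∈ H :=
  h.prod_mem _ (by simp [ha, hb]) hab

namespace IsSubgroup

variable {H : Set L} (h : IsSubgroup H)
include h

theorem one_mem : one L ∈ H := h.isPartialSubgroup.one_mem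

theorem pair_mem {a b : L} (ha : a ∈ H) (hb : b ∈ H) : [a, b] ∈ D :=
  h.word_mem _ (by simp [ha, hb])

theorem mul_mem {a b : L} (ha : a ∈ H) (hb : b ∈ H) : mul a b ∈ H :=
  h.isPartialSubgroup.mul_mem ha hb (h.pair_mem ha hb)

theorem inv_mem {a : L} (ha : a ∈ H) : inv a ∈ H := h.isPartialSubgroup.inv_mem a ha

theorem mem_conjDom {a b : L} (ha : a ∈ H) (hb : b ∈ H) : a ∈ conjDom b :=
  h.word_mem _ (by simp [ha, hb, h.inv_mem hb])

theorem conj_mem {a b : L} (ha : a ∈ H) (hb : b ∈ H) : conj a b ∈ H :=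
  h.isPartialSubgroup.prod_mem _ (by simp [ha, hb, h.inv_mem hb]) (h.mem_conjDom ha hb)

theorem conj_eq {a b : L} (ha : a ∈ H) (hb : b ∈ H) : conj a b = mul (mul (inv b) a) b :=
  prod_append_left (u := [inv b, a]) (v := [b]) (h.mem_conjDom ha hb)

theorem conjEq_self {a : L} (ha : a ∈ H) : ConjEq H a H := by
  refine ⟨fun x hx => h.mem_conjDom hx ha, Set.Subset.antisymm ?_ ?_⟩
  · rintro _ ⟨x, hx, rfl⟩
    exact h.conj_mem hx ha
  · intro x hx
    have hi := h.inv_mem ha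
    exact ⟨conj x (inv a), h.conj_mem hx hi, (conj_inv_conj (h.mem_conjDom hx hi)).2⟩

theorem of_subset {K : Set L} (hK : K ⊆ H) (hne : K.Nonempty)
    (hmul : ∀ a ∈ K, ∀ b ∈ K, mul a b ∈ K) (hinv : ∀ a ∈ K, inv a ∈ K) : IsSubgroup K := by
  have hw : ∀ w : List L, (∀ x ∈ w, x ∈ K) → w ∈ D :=
    fun w hw => h.word_mem w fun x hx => hK (hw x hx)
  refine ⟨⟨hne, hinv, fun w hwK _ => ?_⟩, hw⟩
  induction w with
  | nil =>
    obtain ⟨a, ha⟩ := hne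
    have := hmul _ ha _ (hinv a ha)
    rwa [mul_inv_self] at this
  | cons a w ih =>
    rw [prod_cons (hw _ hwK)]
    have hwK' : ∀ x ∈ w, x ∈ K := fun x hx => hwK x (by simp [hx])
    exact hmul _ (hwK a (by simp)) _ (ih hwK' (hw _ hwK'))

theorem mul_conj {a b g : L} (ha : a ∈ H) (hb : b ∈ H) (hg : g ∈ H) :
    conj (mul a b) g = mul (conj a g) (conj b g) :=
  (PartialGroup.mul_conj (h.word_mem _ (by simp [ha, hb, hg, h.inv_mem hg]))).2.2

/-- A subgroup of a partial group is a group. -/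
@[reducible] def group : Group H where
  mul a b := ⟨mul a.1 b.1, h.mul_mem a.2 b.2⟩
  one := ⟨one L, h.one_mem⟩
  inv a := ⟨inv a.1, h.inv_mem a.2⟩
  mul_assoc a b c := Subtype.ext (mul_mul_eq (h.word_mem _ (by simp)))
  one_mul a := Subtype.ext (one_mul_eq _)
  mul_one a := Subtype.ext (mul_one_eq _)
  inv_mul_cancel a := Subtype.ext (inv_mul_self _)

theorem coe_pow (a : H) (n : ℕ) : letI := h.group; (a ^ n : H).1 = prod (List.replicate n a.1) := by
  let _ := h.group
  induction n with
  | zero => rfl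
  | succ n ih =>
    rw [pow_succ', List.replicate_succ, prod_cons, ← ih]
    · rfl
    · exact h.word_mem _ (by simp [List.mem_replicate])

end IsSubgroup

end Words

end PartialGroup

namespace PartialGroup

/-! ### Conjugation between objects, the sets S_w, and the ⋆-closure. -/

section Objective

variable {L : Type u} [PartialGroup L]

/-- `g` conjugates the object `P` to the object `Q`. -/
structure Moves (Δ : Set (Set L)) (P : Set L) (g : L) (Q : Set L) : Prop where
  left_mem : P ∈ Δ
  right_mem : Q ∈ Δ
  conjEq : ConjEq P g Q

variable {Δ : Set (Set L)} {S : Set L}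

theorem Moves.symm {P Q : Set L} {g : L} (h : Moves Δ P g Q) : Moves Δ Q (inv g) P :=
  ⟨h.right_mem, h.left_mem, h.conjEq.symm⟩

theorem Moves.of_inv {P Q : Set L} {g : L} (h : Moves Δ P (inv g) Q) : Moves Δ Q g P := by
  simpa [inv_inv] using h.symm

theorem Moves.chain_cons {P Q : Set L} {g : L} {w : List L} (h : Moves Δ P g Q)
    (hw : ConjChain Δ Q w) : ConjChain Δ P (g :: w) :=
  ⟨h.left_mem, Q, h.conjEq, hw⟩

theorem ConjChain.head_mem {P : Set L} {w : List L} (h : ConjChain Δ P w) : P ∈ Δ := by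
  cases w with
  | nil => exact h
  | cons g w => exact h.1

theorem ConjChain.exists_moves {P : Set L} {g : L} {w : List L} (h : ConjChain Δ P (g :: w)) :
    ∃ Q, Moves Δ P g Q ∧ ConjChain Δ Q w := by
  obtain ⟨h1, Q, h2, h3⟩ := h
  exact ⟨Q, ⟨h1, h3.head_mem, h2⟩, h3⟩

theorem conjInto_subset (w : List L) : conjInto S w ⊆ S := by
  cases w with
  | nil => exact subset_rfl
  | cons g w => exact fun x hx => hx.1

theorem conjInto_cons_subset (g : L) (w : List L) : conjInto S (g :: w) ⊆ conjInto S [g] :=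
  fun _ hx => ⟨hx.1, hx.2.1, conjInto_subset w hx.2.2⟩

theorem conj_mem_conjInto_inv {g x : L} (hx : x ∈ conjInto S [g]) :
    conj x g ∈ conjInto S [inv g] :=
  ⟨hx.2.2, (conj_conj_inv hx.2.1).1, by
    change conj (conj x g) (inv g) ∈ S
    rw [(conj_conj_inv hx.2.1).2]; exact hx.1⟩

theorem conjSet_subset_conjInto_inv {X : Set L} {g : L} (h : X ⊆ conjInto S [g]) :
    conjSet X g ⊆ conjInto S [inv g] := by
  rintro _ ⟨x, hx, rfl⟩
  exact conj_mem_conjInto_inv (h hx)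

theorem conjSet_conjSet_inv {X : Set L} {g : L} (h : X ⊆ conjInto S [g]) :
    conjSet (conjSet X g) (inv g) = X :=
  (conjEq_conjSet fun _ hx => (h hx).2.1).symm.2

theorem subset_star (X : Set L) : X ⊆ star S X := by
  intro x hx
  simp only [star, Set.mem_iInter]
  exact fun w hw => hw hx

theorem star_subset_conjInto {X : Set L} {w : List L} (h : X ⊆ conjInto S w) :
    star S X ⊆ conjInto S w :=
  fun _ hx => Set.mem_iInter₂.1 hx w h

theorem star_subset {X : Set L} (h : X ⊆ S) : star S X ⊆ S := star_subset_conjInto (w := []) h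

theorem star_subset_star {X Y : Set L} (h : X ⊆ star S Y) : star S X ⊆ star S Y := by
  intro x hx
  exact Set.mem_iInter₂.2 fun w hw =>
    star_subset_conjInto (h.trans (star_subset_conjInto hw)) hx

theorem star_mono {X Y : Set L} (h : X ⊆ Y) : star S X ⊆ star S Y :=
  star_subset_star (h.trans (subset_star Y))

theorem star_star (X : Set L) : star S (star S X) = star S X :=
  Set.Subset.antisymm (star_subset_star subset_rfl) (subset_star _)

theorem star_conjInto (w : List L) : star S (conjInto S w) = conjInto S w :=
  Set.Subset.antisymm (star_subset_conjInto subset_rfl) (subset_star _)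

/-- If X^g ⊆ S_w, then X ⊆ S_{g∘w}, so S_{g∘w} is one of the sets whose intersection is X^⋆. -/
theorem conjSet_star_subset {X : Set L} {g : L} (h : X ⊆ conjInto S [g]) :
    conjSet (star S X) g ⊆ star S (conjSet X g) := by
  rintro _ ⟨z, hz, rfl⟩
  refine Set.mem_iInter₂.2 fun w hw => ?_
  have h1 : X ⊆ conjInto S (g :: w) := fun x hx => ⟨(h hx).1, (h hx).2.1, hw ⟨x, hx, rfl⟩⟩
  exact (star_subset_conjInto h1 hz).2.2

theorem star_conjSet {X : Set L} {g : L} (h : X ⊆ conjInto S [g]) :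
    star S (conjSet X g) = conjSet (star S X) g := by
  refine Set.Subset.antisymm ?_ (conjSet_star_subset h)
  have h1 := conjSet_subset_conjInto_inv h
  have h2 := conjSet_star_subset h1
  rw [conjSet_conjSet_inv h] at h2
  have h3 := conjSet_conjSet_inv (star_subset_conjInto h1)
  rw [inv_inv] at h3
  rw [← h3]
  exact Set.image_mono h2

namespace IsPreLocality

variable (hS : IsPreLocality Δ S)
include hS

theorem isSubgroup_top : IsSubgroup S := hS.isObjective.isSubgroup S hS.top_mem

theorem isSubgroup {X : Set L} (hX : X ∈ Δ) : IsSubgroup X := hS.isObjective.isSubgroup X hX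

theorem mem_D {P : Set L} {w : List L} (h : ConjChain Δ P w) : w ∈ D :=
  (hS.isObjective.mem_D_iff w).2 ⟨P, h⟩

theorem exists_chain {w : List L} (h : w ∈ D) : ∃ P, ConjChain Δ P w :=
  (hS.isObjective.mem_D_iff w).1 h

theorem moves_self {X : Set L} {x : L} (hX : X ∈ Δ) (hx : x ∈ X) : Moves Δ X x X :=
  ⟨hX, hX, (hS.isSubgroup hX).conjEq_self hx⟩

theorem moves_one {X : Set L} (hX : X ∈ Δ) : Moves Δ X (one L) X :=
  hS.moves_self hX (hS.isSubgroup hX).one_mem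

/-- This is the overgroup axiom applied to conjugation by the identity. -/
theorem mem_of_subset {X Z : Set L} (hX : X ∈ Δ) (hXZ : X ⊆ Z) (hZS : Z ⊆ S)
    (hZ : IsSubgroup Z) : Z ∈ Δ :=
  hS.isObjective.overgroup_mem X hX S hS.top_mem (one L) X (hS.moves_one hX).conjEq
    (hS.isSubgroup hX) (hS.subset_top X hX) Z hZ hXZ hZS

theorem pair_mem {P Q R : Set L} {g h : L} (hg : Moves Δ P g Q) (hh : Moves Δ Q h R) :
    [g, h] ∈ D :=
  hS.mem_D (hg.chain_cons (hh.chain_cons hh.right_mem))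

theorem conj_mul_of_moves {P Q R : Set L} {g h x : L} (hg : Moves Δ P g Q) (hh : Moves Δ Q h R)
    (hx : Moves Δ P x P) :
    x ∈ conjDom (mul g h) ∧ conj x (mul g h) = conj (conj x g) h :=
  conj_mul (hS.mem_D (hh.symm.chain_cons (hg.symm.chain_cons (hx.chain_cons
    (hg.chain_cons (hh.chain_cons hh.right_mem))))))

theorem moves_mul {P Q R : Set L} {g h : L} (hg : Moves Δ P g Q) (hh : Moves Δ Q h R) :
    Moves Δ P (mul g h) R := by
  have key := fun x (hx : x ∈ P) =>
    hS.conj_mul_of_moves hg hh (hS.moves_self hg.left_mem hx)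
  refine ⟨hg.left_mem, hh.right_mem, fun x hx => (key x hx).1, ?_⟩
  rw [← hh.conjEq.2, ← hg.conjEq.2, Set.image_image]
  exact Set.image_congr fun x hx => (key x hx).2

theorem mem_conjDom_of_moves {P Q : Set L} {g x : L} (hg : Moves Δ P g Q) (hx : Moves Δ P x P) :
    x ∈ conjDom g :=
  hS.mem_D (hg.symm.chain_cons (hx.chain_cons (hg.chain_cons hg.right_mem)))

theorem moves_conj {P Q : Set L} {g x : L} (hg : Moves Δ P g Q) (hx : Moves Δ P x P) :
    Moves Δ Q (conj x g) Q := by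
  have h1 := hS.mem_conjDom_of_moves hg hx
  have : conj x g = mul (inv g) (mul x g) := prod_cons h1
  rw [this]
  exact hS.moves_mul hg.symm (hS.moves_mul hx hg)

theorem mul_conj_of_moves {P Q : Set L} {g x y : L} (hg : Moves Δ P g Q) (hx : Moves Δ P x P)
    (hy : Moves Δ P y P) : conj (mul x y) g = mul (conj x g) (conj y g) :=
  (mul_conj (hS.mem_D (hg.symm.chain_cons (hx.chain_cons (hg.chain_cons (hg.symm.chain_cons
    (hy.chain_cons (hg.chain_cons hg.right_mem)))))))).2.2

theorem moves_prod {P : Set L} {w : List L} (hP : P ∈ Δ) (h : ∀ x ∈ w, Moves Δ P x P) :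
    ConjChain Δ P w ∧ Moves Δ P (prod w) P := by
  induction w with
  | nil => exact ⟨hP, hS.moves_one hP⟩
  | cons a w ih =>
    obtain ⟨h1, h2⟩ := ih fun x hx => h x (by simp [hx])
    have h3 := (h a (by simp)).chain_cons h1
    refine ⟨h3, ?_⟩
    rw [prod_cons (hS.mem_D h3)]
    exact hS.moves_mul (h a (by simp)) h2

/-- The elements of a partial subgroup that normalize an object form a subgroup. -/
theorem isSubgroup_normalizer {M P : Set L} (hM : IsPartialSubgroup M) (hP : P ∈ Δ) :
    IsSubgroup {g | g ∈ M ∧ Moves Δ P g P} := by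
  have key : ∀ w : List L, (∀ x ∈ w, x ∈ {g | g ∈ M ∧ Moves Δ P g P}) → ∀ x ∈ w, Moves Δ P x P :=
    fun w hw x hx => (hw x hx).2
  refine ⟨⟨⟨one L, hM.one_mem, hS.moves_one hP⟩, fun x hx => ⟨hM.inv_mem x hx.1, hx.2.symm⟩,
    fun w hw hD => ⟨hM.prod_mem w (fun x hx => (hw x hx).1) hD,
      (hS.moves_prod hP (key w hw)).2⟩⟩, fun w hw => hS.mem_D (hS.moves_prod hP (key w hw)).1⟩

theorem moves_conjSet_of_mem {X : Set L} {a : L} (hX : X ∈ Δ) (ha : a ∈ S) :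
    Moves Δ X a (conjSet X a) := by
  have hT := hS.isSubgroup_top
  have hXS := hS.subset_top X hX
  have hXs := hS.isSubgroup hX
  have hc : ConjEq X a (conjSet X a) := conjEq_conjSet fun x hx => hT.mem_conjDom (hXS hx) ha
  have hsub : conjSet X a ⊆ S := by
    rintro _ ⟨x, hx, rfl⟩
    exact hT.conj_mem (hXS hx) ha
  have hsg : IsSubgroup (conjSet X a) := by
    refine hT.of_subset hsub ⟨_, _, hXs.one_mem, rfl⟩ ?_ ?_
    · rintro _ ⟨x, hx, rfl⟩ _ ⟨y, hy, rfl⟩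
      exact ⟨mul x y, hXs.mul_mem hx hy, hT.mul_conj (hXS hx) (hXS hy) ha⟩
    · rintro _ ⟨x, hx, rfl⟩
      exact ⟨inv x, hXs.inv_mem hx, (conj_inv (hc.1 hx)).2⟩
  exact ⟨hX, hS.isObjective.overgroup_mem X hX S hS.top_mem a _ hc hsg hsub _ hsg
    subset_rfl hsub, hc⟩

/-- For a ∈ S_g one has g = a g (a^g)⁻¹, so g can be followed through X^{a⁻¹} → X → Y → Y^{(a^g)⁻¹}.
This supplies objects for words in which g occurs together with elements of S_g. -/
theorem moves_conjSet_inv {X Y : Set L} {g a : L} (h : Moves Δ X g Y) (ha : a ∈ conjInto S [g]) :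
    Moves Δ (conjSet X (inv a)) g (conjSet Y (inv (conj a g))) := by
  obtain ⟨haS, had, hag⟩ := ha
  have hT := hS.isSubgroup_top
  have h1 := (hS.moves_conjSet_of_mem h.left_mem (hT.inv_mem haS)).of_inv
  have h2 := hS.moves_conjSet_of_mem h.right_mem (hT.inv_mem hag)
  have h3 := hS.moves_mul (hS.moves_mul h1 h) h2
  have hd : [inv g, a, g] ∈ D := had
  have h4 : [g, inv g, a, g] ∈ D := by
    simpa [invWord, inv_inv] using invWord_append_append_mem (u := [inv g]) (v := [a, g]) hd
  have h5 : [g, conj a g] ∈ D := contract_mem [g] [inv g, a, g] [] h4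
  have h6 : mul g (conj a g) = mul a g :=
    (prod_cons h4).symm.trans (cancel (u := []) (w := [a, g]) h4).2
  have h7 : [g, conj a g, inv (conj a g)] ∈ D := append_append_invWord_mem (u := [g]) h5
  have h8 : mul (mul a g) (inv (conj a g)) = g := by
    rw [← h6, mul_mul_eq h7, mul_inv_self, mul_one_eq]
  rwa [h8] at h3

theorem conjInto_one_inv {g a : L} (ha : a ∈ conjInto S [g]) : inv a ∈ conjInto S [g] :=
  ⟨hS.isSubgroup_top.inv_mem ha.1, (conj_inv ha.2.1).1, by
    rw [(conj_inv ha.2.1).2]; exact hS.isSubgroup_top.inv_mem ha.2.2⟩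

theorem exists_moves (g : L) : ∃ X Y, Moves Δ X g Y := by
  obtain ⟨X, hX⟩ := hS.exists_chain (singleton_mem g)
  obtain ⟨Y, hY, -⟩ := hX.exists_moves
  exact ⟨X, Y, hY⟩

theorem mul_conj_of_mem {g a b : L} (ha : a ∈ conjInto S [g]) (hb : b ∈ conjInto S [g]) :
    mul a b ∈ conjDom g ∧ conj (mul a b) g = mul (conj a g) (conj b g) := by
  obtain ⟨X, Y, h⟩ := hS.exists_moves g
  have h1 := hS.moves_conjSet_inv h ha
  have h2 := (hS.moves_conjSet_of_mem h.left_mem (hS.isSubgroup_top.inv_mem ha.1)).of_inv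
  have h3 := hS.moves_conjSet_inv h (hS.conjInto_one_inv hb)
  rw [inv_inv] at h3
  have h4 := hS.moves_conjSet_of_mem h.left_mem hb.1
  -- The word (g⁻¹, a, g, g⁻¹, b, g) runs through Y^{(a^g)⁻¹}, X^{a⁻¹}, X, Y, X, X^b, Y^{b^g}.
  have := mul_conj (hS.mem_D (h1.symm.chain_cons (h2.chain_cons (h.chain_cons
    (h.symm.chain_cons (h4.chain_cons (h3.chain_cons h3.right_mem)))))))
  exact ⟨this.1, this.2.2⟩

theorem isSubgroup_conjInto (w : List L) : IsSubgroup (conjInto S w) := by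
  have hT := hS.isSubgroup_top
  induction w with
  | nil => exact hT
  | cons g w ih =>
    refine hT.of_subset (conjInto_subset _) ⟨one L, hT.one_mem, conj_one.1, ?_⟩ ?_ ?_
    · rw [conj_one.2]; exact ih.one_mem
    · intro a ha b hb
      obtain ⟨h1, h2⟩ := hS.mul_conj_of_mem (conjInto_cons_subset g w ha)
        (conjInto_cons_subset g w hb)
      exact ⟨hT.mul_mem ha.1 hb.1, h1, by rw [h2]; exact ih.mul_mem ha.2.2 hb.2.2⟩
    · intro a ha
      exact ⟨hT.inv_mem ha.1, (conj_inv ha.2.1).1, by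
        rw [(conj_inv ha.2.1).2]; exact ih.inv_mem ha.2.2⟩

theorem subset_conjInto {X Y : Set L} {g : L} (h : Moves Δ X g Y) : X ⊆ conjInto S [g] :=
  fun _ hx => ⟨hS.subset_top X h.left_mem hx, h.conjEq.1 hx,
    hS.subset_top Y h.right_mem (h.conjEq.mem hx)⟩

theorem conjInto_mem (g : L) : conjInto S [g] ∈ Δ := by
  obtain ⟨X, Y, h⟩ := hS.exists_moves g
  exact hS.mem_of_subset h.left_mem (hS.subset_conjInto h) (conjInto_subset _)
    (hS.isSubgroup_conjInto _)

theorem isSubgroup_conjSet {X : Set L} {g : L} (hX : IsSubgroup X) (h : X ⊆ conjInto S [g]) :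
    IsSubgroup (conjSet X g) := by
  have hsub : conjSet X g ⊆ S := by
    rintro _ ⟨x, hx, rfl⟩
    exact (h hx).2.2
  refine hS.isSubgroup_top.of_subset hsub ⟨_, _, hX.one_mem, rfl⟩ ?_ ?_
  · rintro _ ⟨x, hx, rfl⟩ _ ⟨y, hy, rfl⟩
    exact ⟨mul x y, hX.mul_mem hx hy, (hS.mul_conj_of_mem (h hx) (h hy)).2⟩
  · rintro _ ⟨x, hx, rfl⟩
    exact ⟨inv x, hX.inv_mem hx, (conj_inv (h hx).2.1).2⟩

theorem moves_conjSet {X : Set L} {g : L} (hX : X ∈ Δ) (h : X ⊆ conjInto S [g]) :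
    Moves Δ X g (conjSet X g) := by
  have hc : ConjEq X g (conjSet X g) := conjEq_conjSet fun x hx => (h hx).2.1
  have hsub : conjSet X g ⊆ S := by
    rintro _ ⟨x, hx, rfl⟩
    exact (h hx).2.2
  have hsg := hS.isSubgroup_conjSet (hS.isSubgroup hX) h
  exact ⟨hX, hS.isObjective.overgroup_mem X hX S hS.top_mem g _ hc hsg hsub _ hsg
    subset_rfl hsub, hc⟩

theorem isSubgroup_star {X : Set L} (h : X ⊆ S) : IsSubgroup (star S X) := by
  refine hS.isSubgroup_top.of_subset (star_subset h)
    ⟨one L, Set.mem_iInter₂.2 fun w _ => (hS.isSubgroup_conjInto w).one_mem⟩ ?_ ?_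
  · exact fun a ha b hb => Set.mem_iInter₂.2 fun w hw => (hS.isSubgroup_conjInto w).mul_mem
      (Set.mem_iInter₂.1 ha w hw) (Set.mem_iInter₂.1 hb w hw)
  · exact fun a ha => Set.mem_iInter₂.2 fun w hw => (hS.isSubgroup_conjInto w).inv_mem
      (Set.mem_iInter₂.1 ha w hw)

theorem star_mem_omega {X : Set L} (h : X ⊆ S) : star S X ∈ Omega S :=
  ⟨star S X, hS.isSubgroup_star h, star_subset h, (star_star X).symm⟩

end IsPreLocality

end Objective

end PartialGroup

namespace PartialGroup

/-! ### Heights in Ω_S(L) as a bounded rank invariant under conjugation. -/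

section Rank

variable {L : Type u} [PartialGroup L]

open Classical in
/-- The height of `X ^ ⋆` in `Ω_S(L)`. -/
noncomputable def rank (S X : Set L) : ℕ :=
  if h : star S X ∈ Omega S then (Order.height (⟨star S X, h⟩ : Omega S)).toNat else 0

variable {Δ : Set (Set L)} {S : Set L}

theorem height_lt_top (hf : FiniteDim S) (X : Omega S) : Order.height X < ⊤ :=
  WithBot.coe_lt_coe.1 (lt_of_le_of_lt (Order.height_le_krullDim X) hf)

namespace IsPreLocality

variable (hS : IsPreLocality Δ S)
include hS

/-- For X ⊆ S the default branch of `rank` is not taken, and finite dimension makes the height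
finite, so `toNat` loses nothing. -/
theorem coe_rank (hf : FiniteDim S) {X : Set L} (hX : X ⊆ S) :
    (rank S X : ℕ∞) = Order.height (⟨star S X, hS.star_mem_omega hX⟩ : Omega S) := by
  rw [rank, dif_pos (hS.star_mem_omega hX)]
  exact ENat.natCast_toNat (height_lt_top hf _).ne

theorem exists_rank_le (hf : FiniteDim S) : ∃ K : ℕ, ∀ X ⊆ S, rank S X ≤ K := by
  have h0 : ((rank S S : ℕ∞) : WithBot ℕ∞) ≤ Order.krullDim (Omega S) := by
    rw [hS.coe_rank hf subset_rfl]
    exact Order.height_le_krullDim _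
  obtain ⟨K, hK⟩ : ∃ K : ℕ, Order.krullDim (Omega S) = ((K : ℕ∞) : WithBot ℕ∞) := by
    have hf' : Order.krullDim (Omega S) < ⊤ := hf
    generalize Order.krullDim (Omega S) = d at h0 hf'
    induction d using WithBot.recBotCoe with
    | bot => simp at h0
    | coe d =>
      obtain ⟨K, rfl⟩ := ENat.ne_top_iff_exists.1 (WithBot.coe_lt_coe.1 hf').ne
      exact ⟨K, rfl⟩
  refine ⟨K, fun X hX => ?_⟩
  have h1 := Order.height_le_krullDim (⟨star S X, hS.star_mem_omega hX⟩ : Omega S)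
  rw [← hS.coe_rank hf hX, hK] at h1
  exact_mod_cast h1

/-- Finite height is strictly monotone, so comparable closed sets of equal rank coincide. All
maximality arguments below end here. -/
theorem star_eq_of_rank_le (hf : FiniteDim S) {X Y : Set L} (hX : X ⊆ S) (hY : Y ⊆ S)
    (h : star S X ⊆ star S Y) (hr : rank S Y ≤ rank S X) : star S X = star S Y := by
  by_contra hne
  have hlt : (⟨star S X, hS.star_mem_omega hX⟩ : Omega S) < ⟨star S Y, hS.star_mem_omega hY⟩ :=
    lt_of_le_of_ne h fun e => hne (congrArg Subtype.val e)
  have h1 := Order.height_strictMono hlt (height_lt_top hf _)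
  rw [← hS.coe_rank hf hX, ← hS.coe_rank hf hY] at h1
  have h2 : rank S X < rank S Y := by exact_mod_cast h1
  omega

/-- Conjugation by g commutes with ⋆ and is injective on S_g, so it embeds the closed sets below X^⋆
into those below (X^g)^⋆. -/
theorem height_le_height_conjSet {X : Set L} {g : L} (hX : X ⊆ conjInto S [g])
    (h1 : star S X ∈ Omega S)
    (h2 : star S (conjSet X g) ∈ Omega S) :
    Order.height (⟨star S X, h1⟩ : Omega S) ≤
      Order.height (⟨star S (conjSet X g), h2⟩ : Omega S) := by
  have key : ∀ Y : Omega S, Y.1 ⊆ star S X →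
      conjSet Y.1 g ∈ Omega S ∧ conjSet Y.1 g ⊆ star S (conjSet X g) := by
    rintro ⟨_, Y, hY, hYS, rfl⟩ h
    have h3 := (subset_star Y).trans (h.trans (star_subset_conjInto hX))
    rw [← star_conjSet h3, ← star_star (conjSet X g)]
    refine ⟨hS.star_mem_omega ?_, star_mono ?_⟩
    · rintro _ ⟨y, hy, rfl⟩
      exact (h3 hy).2.2
    · rw [star_conjSet hX]
      exact Set.image_mono ((subset_star Y).trans h)
  let f : Set.Iic (⟨star S X, h1⟩ : Omega S) → Set.Iic (⟨star S (conjSet X g), h2⟩ : Omega S) :=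
    fun Y => ⟨⟨conjSet Y.1.1 g, (key Y.1 Y.2).1⟩, (key Y.1 Y.2).2⟩
  have hf : StrictMono f := by
    intro Y Z hYZ
    have h3 : Y.1.1 ⊆ Z.1.1 := hYZ.le
    refine lt_of_le_of_ne (Set.image_mono h3 : conjSet Y.1.1 g ⊆ conjSet Z.1.1 g) fun e => ?_
    have e' : conjSet Y.1.1 g = conjSet Z.1.1 g :=
      congrArg (fun W => (W.1.1 : Set L)) e
    have h4 : ∀ W : Set.Iic (⟨star S X, h1⟩ : Omega S), W.1.1 ⊆ conjInto S [g] := fun W =>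
      (show W.1.1 ⊆ star S X from W.2).trans (star_subset_conjInto hX)
    have h5 := conjSet_conjSet_inv (h4 Y)
    rw [e', conjSet_conjSet_inv (h4 Z)] at h5
    exact hYZ.ne (Subtype.ext (Subtype.ext h5.symm))
  have := Order.krullDim_le_of_strictMono f hf
  rw [← Order.height_eq_krullDim_Iic, ← Order.height_eq_krullDim_Iic] at this
  exact WithBot.coe_le_coe.1 this

theorem rank_conjSet (hf : FiniteDim S) {X : Set L} {g : L} (hX : X ⊆ conjInto S [g]) :
    rank S (conjSet X g) = rank S X := by
  have hXg := conjSet_subset_conjInto_inv hX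
  have h1 : X ⊆ S := hX.trans (conjInto_subset _)
  have h2 : conjSet X g ⊆ S := hXg.trans (conjInto_subset _)
  have key : ∀ {Y : Set L} {g : L}, Y ⊆ conjInto S [g] → rank S Y ≤ rank S (conjSet Y g) := by
    intro Y g hY
    have h3 : conjSet Y g ⊆ S := (conjSet_subset_conjInto_inv hY).trans (conjInto_subset _)
    have : (rank S Y : ℕ∞) ≤ rank S (conjSet Y g) := by
      rw [hS.coe_rank hf (hY.trans (conjInto_subset _)), hS.coe_rank hf h3]
      exact hS.height_le_height_conjSet hY _ _
    exact_mod_cast this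
  refine le_antisymm ?_ (key hX)
  have := key hXg
  rwa [conjSet_conjSet_inv hX] at this

theorem exists_finite_star_eq (hf : FiniteDim S) {X : Set L} (hX : X ⊆ S) :
    ∃ F : Set L, F.Finite ∧ F ⊆ X ∧ star S F = star S X := by
  obtain ⟨K, hK⟩ := hS.exists_rank_le hf
  -- Minimizing K − rank amounts to choosing a finite F ⊆ X of maximal rank. Adding any x ∈ X cannot
  -- raise the rank, so x already lies in F^⋆.
  have hex : ∃ n, ∃ F : Set L, F.Finite ∧ F ⊆ X ∧ K - rank S F = n :=
    ⟨_, ∅, Set.finite_empty, Set.empty_subset _, rfl⟩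
  classical
  obtain ⟨F, hF, hFX, hn⟩ := Nat.find_spec hex
  refine ⟨F, hF, hFX, Set.Subset.antisymm (star_mono hFX) (star_subset_star fun x hx => ?_)⟩
  have h1 : insert x F ⊆ X := Set.insert_subset hx hFX
  have h2 := Nat.find_min' hex ⟨insert x F, hF.insert x, h1, rfl⟩
  have h3 := hK F (hFX.trans hX)
  have h4 := hK _ (h1.trans hX)
  have h5 := hS.star_eq_of_rank_le hf (hFX.trans hX) (h1.trans hX)
    (star_mono (Set.subset_insert x F)) (by omega)
  rw [h5]
  exact subset_star _ (Set.mem_insert x F)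

end IsPreLocality

end Rank

end PartialGroup

/-! ### Normalizers and Sylow subgroups in finite groups. -/

section Group

variable {G : Type*} [Group G] {p : ℕ}

theorem IsPGroup.exists_notMem_conj_mem [Finite G] (hp : p.Prime) (hG : IsPGroup p G)
    {A : Subgroup G} (hA : A ≠ ⊤) : ∃ y ∉ A, ∀ a ∈ A, y⁻¹ * a * y ∈ A := by
  have := Fact.mk hp
  have := hG.isNilpotent
  have h := Group.normalizerCondition_of_isNilpotent (G := G) A hA.lt_top
  obtain ⟨y, hy, hyA⟩ := SetLike.exists_of_lt h
  exact ⟨y, hyA, fun a ha => (Subgroup.mem_normalizer_iff''.1 hy a).1 ha⟩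

open scoped Pointwise in
/-- If every `p`-element that normalizes the `p`-subgroup `A` is in `A`, then `A` is a Sylow
subgroup, hence every `p`-element has a conjugate in `A`. -/
theorem IsPGroup.exists_conj_mem [Finite G] (hp : p.Prime) {A : Subgroup G} (hA : IsPGroup p A)
    (h : ∀ y : G, (∃ k : ℕ, y ^ p ^ k = 1) → (∀ a ∈ A, y⁻¹ * a * y ∈ A) → y ∈ A)
    {x : G} (hx : ∃ k : ℕ, x ^ p ^ k = 1) : ∃ c : G, c⁻¹ * x * c ∈ A := by
  have := Fact.mk hp
  obtain ⟨Y, hAY⟩ := hA.exists_le_sylow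
  -- If A were proper in the Sylow subgroup Y, the normalizer condition in Y would give a p-element
  -- outside A normalizing A.
  have hYA : (Y : Subgroup G) ≤ A := by
    by_contra hne
    have h1 : A.subgroupOf Y ≠ ⊤ := fun e => hne (Subgroup.subgroupOf_eq_top.1 e)
    obtain ⟨y, hy, hyc⟩ := Y.isPGroup'.exists_notMem_conj_mem hp h1
    refine hy (h y.1 ?_ fun a ha => ?_)
    · obtain ⟨k, hk⟩ := Y.isPGroup' y
      exact ⟨k, by simpa using congrArg Subtype.val hk⟩
    · exact hyc ⟨a, hAY ha⟩ ha
  have hxp : IsPGroup p (Subgroup.zpowers x) := by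
    obtain ⟨k, hk⟩ := hx
    rintro ⟨z, hz⟩
    obtain ⟨n, rfl⟩ := Subgroup.mem_zpowers_iff.1 hz
    refine ⟨k, Subtype.ext ?_⟩
    change (x ^ n) ^ p ^ k = 1
    rw [← zpow_natCast, zpow_comm, zpow_natCast, hk, one_zpow]
  obtain ⟨Z, hxZ⟩ := hxp.exists_le_sylow
  obtain ⟨c, hc⟩ := MulAction.exists_smul_eq G Z Y
  refine ⟨c⁻¹, hYA ?_⟩
  rw [← hc]
  have : MulAut.conj c • x ∈ MulAut.conj c • (Z : Subgroup G) :=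
    Subgroup.smul_mem_pointwise_smul _ _ _ (hxZ (Subgroup.mem_zpowers x))
  rw [MulAut.smul_def, MulAut.conj_apply] at this
  rwa [inv_inv]

end Group

namespace PartialGroup

/-! ### Transfer of the finite group results to subgroups of a partial group. -/

section PElements

variable {L : Type u} [PartialGroup L]

/-- Elements of `p`-power order. -/
def IsPElement (p : ℕ) (x : L) : Prop := ∃ k : ℕ, prod (List.replicate (p ^ k) x) = one L

namespace IsSubgroup

variable {H : Set L} (h : IsSubgroup H)
include h

theorem isPElement_iff {p : ℕ} (x : H) :
    letI := h.group; IsPElement p x.1 ↔ ∃ k : ℕ, x ^ p ^ k = 1 := by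
  let _ := h.group
  refine exists_congr fun k => ?_
  rw [← h.coe_pow, Subtype.ext_iff]
  rfl

/-- A subgroup `A ⊆ H` of a partial group, as a subgroup of the group `H`. -/
@[reducible] def restrict {A : Set L} (hA : IsSubgroup A) : letI := h.group; Subgroup H :=
  letI := h.group
  { carrier := {x | x.1 ∈ A}
    mul_mem' := fun ha hb => hA.mul_mem ha hb
    one_mem' := hA.one_mem
    inv_mem' := fun ha => hA.inv_mem ha }

theorem isPGroup_restrict {p : ℕ} {A : Set L} (hA : IsSubgroup A)
    (hp : ∀ a ∈ A, IsPElement p a) : letI := h.group; IsPGroup p (h.restrict hA) := by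
  let _ := h.group
  rintro ⟨x, hx⟩
  obtain ⟨k, hk⟩ := (h.isPElement_iff x).1 (hp x.1 hx)
  exact ⟨k, Subtype.ext hk⟩

theorem coe_conj (a b : H) : letI := h.group; (b⁻¹ * a * b : H).1 = conj a.1 b.1 := by
  let _ := h.group
  exact (h.conj_eq a.2 b.2).symm

theorem exists_notMem_conj_mem {p : ℕ} (hp : p.Prime) (hfin : H.Finite)
    (hpH : ∀ x ∈ H, IsPElement p x) {A : Set L} (hA : IsSubgroup A) (hHA : ¬ H ⊆ A) :
    ∃ y ∈ H, y ∉ A ∧ ∀ a ∈ A, a ∈ H → conj a y ∈ A := by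
  let _ := h.group
  have : Finite H := hfin
  have hG : IsPGroup p H := fun x => (h.isPElement_iff x).1 (hpH x.1 x.2)
  have hne : h.restrict hA ≠ ⊤ := fun e => hHA fun x hx => by
    have : (⟨x, hx⟩ : H) ∈ h.restrict hA := e ▸ Subgroup.mem_top _
    exact this
  obtain ⟨y, hy, hyA⟩ := hG.exists_notMem_conj_mem hp hne
  refine ⟨y.1, y.2, hy, fun a ha haH => ?_⟩
  have : (y⁻¹ * ⟨a, haH⟩ * y : H).1 ∈ A := hyA ⟨a, haH⟩ ha
  rwa [h.coe_conj] at this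

theorem exists_conj_mem {p : ℕ} (hp : p.Prime) (hfin : H.Finite) {A : Set L} (hA : IsSubgroup A)
    (hAH : A ⊆ H) (hpA : ∀ x ∈ A, IsPElement p x)
    (hN : ∀ y ∈ H, IsPElement p y → (∀ a ∈ A, conj a y ∈ A) → y ∈ A)
    {x : L} (hx : x ∈ H) (hxp : IsPElement p x) : ∃ c ∈ H, conj x c ∈ A := by
  let _ := h.group
  have : Finite H := hfin
  obtain ⟨c, hc⟩ := (h.isPGroup_restrict hA hpA).exists_conj_mem hp (x := ⟨x, hx⟩)
    (fun y hy hyA => hN y.1 y.2 ((h.isPElement_iff y).2 hy) fun a ha => by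
      have : (y⁻¹ * ⟨a, hAH ha⟩ * y : H).1 ∈ A := hyA ⟨a, hAH ha⟩ ha
      rwa [h.coe_conj] at this) ((h.isPElement_iff ⟨x, hx⟩).1 hxp)
  refine ⟨c.1, c.2, ?_⟩
  have : (c⁻¹ * ⟨x, hx⟩ * c : H).1 ∈ A := hc
  rwa [h.coe_conj] at this

theorem inter {K : Set L} (hK : IsSubgroup K) : IsSubgroup (H ∩ K) :=
  h.of_subset Set.inter_subset_left ⟨one L, h.one_mem, hK.one_mem⟩
    (fun _ ha _ hb => ⟨h.mul_mem ha.1 hb.1, hK.mul_mem ha.2 hb.2⟩)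
    fun _ ha => ⟨h.inv_mem ha.1, hK.inv_mem ha.2⟩

/-- The elements of a subgroup of the group `H` form a subgroup of the partial group. -/
theorem coe_image : letI := h.group; ∀ A : Subgroup H, IsSubgroup (Subtype.val '' (A : Set H)) := by
  intro A
  let _ := h.group
  refine h.of_subset ?_ ⟨_, 1, A.one_mem, rfl⟩ ?_ ?_
  · rintro _ ⟨x, -, rfl⟩
    exact x.2
  · rintro _ ⟨x, hx, rfl⟩ _ ⟨y, hy, rfl⟩
    exact ⟨x * y, A.mul_mem hx hy, rfl⟩
  · rintro _ ⟨x, hx, rfl⟩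
    exact ⟨x⁻¹, A.inv_mem hx, rfl⟩

/-- A `p`-element of `H` that normalizes a `p`-subgroup `A` generates a `p`-subgroup with `A`. -/
theorem exists_pSubgroup {p : ℕ} (hp : p.Prime) {A : Set L} (hAH : A ⊆ H)
    (hA : IsPSubgroup p A) (hN : ∀ a ∈ A, ∀ g ∈ H, conj a g ∈ A) {y : L} (hy : y ∈ H)
    (hyp : IsPElement p y) : ∃ B, IsPSubgroup p B ∧ A ⊆ B ∧ y ∈ B := by
  let _ := h.group
  have := Fact.mk hp
  have hn : (h.restrict hA.isSubgroup).Normal := by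
    refine ⟨fun a ha g => ?_⟩
    have e := h.coe_conj a g⁻¹
    rw [_root_.inv_inv] at e
    change (g * a * g⁻¹ : H).1 ∈ A
    rw [e]
    exact hN a.1 ha _ (g⁻¹).2
  have h1 := h.isPGroup_restrict hA.isSubgroup hA.pow_eq_one
  have h2 : IsPGroup p (Subgroup.zpowers (⟨y, hy⟩ : H)) := by
    obtain ⟨k, hk⟩ := (h.isPElement_iff ⟨y, hy⟩).1 hyp
    rintro ⟨z, hz⟩
    obtain ⟨n, rfl⟩ := Subgroup.mem_zpowers_iff.1 hz
    refine ⟨k, Subtype.ext ?_⟩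
    change ((⟨y, hy⟩ : H) ^ n) ^ p ^ k = 1
    rw [← zpow_natCast, zpow_comm, zpow_natCast, hk, one_zpow]
  have h3 := h1.to_sup_of_normal_left h2
  refine ⟨_, ⟨h.coe_image _, ?_⟩, fun a ha => ⟨⟨a, hAH ha⟩,
    (le_sup_left : _ ≤ h.restrict hA.isSubgroup ⊔ Subgroup.zpowers (⟨y, hy⟩ : H)) ha, rfl⟩,
    ⟨⟨y, hy⟩, (le_sup_right : _ ≤ h.restrict hA.isSubgroup ⊔ Subgroup.zpowers (⟨y, hy⟩ : H))
      (Subgroup.mem_zpowers _), rfl⟩⟩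
  rintro _ ⟨x, hx, rfl⟩
  obtain ⟨k, hk⟩ := h3 ⟨x, hx⟩
  exact (h.isPElement_iff x).2 ⟨k, congrArg Subtype.val hk⟩

end IsSubgroup

end PElements

/-! ### Growth of normalizers and a Sylow-type theorem in localities. -/

section Sylow

variable {L : Type u} [PartialGroup L] {Δ : Set (Set L)} {S : Set L} {p : ℕ}

namespace IsPreLocality

variable (hS : IsPreLocality Δ S)
include hS

theorem isPElement_conj {P Q : Set L} {g x : L} (hg : Moves Δ P g Q) (hx : Moves Δ P x P)
    (hxp : IsPElement p x) : IsPElement p (conj x g) := by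
  obtain ⟨k, hk⟩ := hxp
  refine ⟨k, ?_⟩
  have key : ∀ n, conj (prod (List.replicate n x)) g = prod (List.replicate n (conj x g)) := by
    intro n
    have h1 : ∀ {R : Set L} {z : L} (n : ℕ), Moves Δ R z R →
        ConjChain Δ R (List.replicate n z) ∧ Moves Δ R (prod (List.replicate n z)) R :=
      fun n hz => hS.moves_prod hz.left_mem fun y hy => by
        rw [List.eq_of_mem_replicate hy]; exact hz
    induction n with
    | zero => exact conj_one.2
    | succ n ih =>
      have h2 := hS.moves_conj hg hx
      rw [List.replicate_succ, List.replicate_succ, prod_cons, prod_cons,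
        hS.mul_conj_of_moves hg hx (h1 n hx).2, ih]
      · exact hS.mem_D (h1 (n + 1) h2).1
      · exact hS.mem_D (h1 (n + 1) hx).1
  rw [← key, hk, conj_one.2]

/-- A^y ⊆ A has the same rank as A, so both have the same closure, and conjugation commutes with
closure. -/
theorem moves_star {A : Set L} {y : L} (hf : FiniteDim S) (hA : star S A ∈ Δ)
    (hAS : A ⊆ S) (hyA : ∀ a ∈ A, a ∈ conjDom y ∧ conj a y ∈ A) :
    Moves Δ (star S A) y (star S A) := by
  have h1 : A ⊆ conjInto S [y] := fun a ha => ⟨hAS ha, (hyA a ha).1, hAS (hyA a ha).2⟩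
  have h2 := hS.moves_conjSet hA (star_subset_conjInto h1)
  have h3 : conjSet A y ⊆ A := by
    rintro _ ⟨a, ha, rfl⟩
    exact (hyA a ha).2
  have h4 := hS.star_eq_of_rank_le hf (h3.trans hAS) hAS (star_mono h3)
    (hS.rank_conjSet hf h1).ge
  rwa [← star_conjSet h1, h4] at h2

/-- The normalizer of a `⋆`-closed object in a larger `p`-subgroup of `S` is larger. -/
theorem exists_moves_notMem (hf : FiniteDim S) (hp : p.Prime) (hSp : ∀ x ∈ S, IsPElement p x)
    (hlf : ∀ H : Set L, IsSubgroup H → LocallyFiniteIn H) {X : Set L} (hX : X ∈ Δ)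
    (hXs : star S X = X) {P : Set L}
    (hP : IsSubgroup P) (hPS : P ⊆ S) (hXP : X ⊆ P) (hne : ¬ P ⊆ X) :
    ∃ y ∈ P, y ∉ X ∧ Moves Δ X y X := by
  have hXS := hS.subset_top X hX
  obtain ⟨F, hF, hFX, hFs⟩ := hS.exists_finite_star_eq hf hXS
  obtain ⟨x, hxP, hxX⟩ := Set.not_subset.1 hne
  -- Since F ⊆ X ∩ K ⊆ X, the closure of X ∩ K is X. Hence normalizing X ∩ K, a condition inside a
  -- finite p-group, suffices to normalize X.
  obtain ⟨K, hK, hKfin, hFK, hKP⟩ := hlf P hP (insert x F) (hF.insert x)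
    (Set.insert_subset hxP (hFX.trans hXP))
  obtain ⟨y, hyK, hyX, hy⟩ := hK.exists_notMem_conj_mem hp hKfin
    (fun z hz => hSp z (hPS (hKP hz))) (hS.isSubgroup hX) fun h => hxX (h (hFK (Set.mem_insert x F)))
  have hs : star S (X ∩ K) = X := by
    refine Set.Subset.antisymm ?_ ?_
    · exact (star_mono Set.inter_subset_left).trans hXs.subset
    · refine (hFs.trans hXs).ge.trans ?_
      exact star_mono (Set.subset_inter hFX ((Set.subset_insert x F).trans hFK))
  have := hS.moves_star hf (hs.symm ▸ hX) (Set.inter_subset_left.trans hXS) fun a ha =>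
    ⟨hK.mem_conjDom ha.2 hyK, hy a ha.1 ha.2, hK.conj_mem ha.2 hyK⟩
  rw [hs] at this
  exact ⟨y, hKP hyK, hyX, this⟩

/-- A `p`-element of `M` that normalizes an object has a conjugate in `S`, by an element of `M`
that conjugates the object to an object. -/
theorem exists_moves_conj_mem (hf : FiniteDim S) (hp : p.Prime) (hmax : Maximal (IsPSubgroup p) S)
    (hlf : ∀ H : Set L, IsSubgroup H → LocallyFiniteIn H) {M : Set L} (hM : IsPartialSubgroup M)
    (hSM : S ⊆ M) {V : Set L} (hV : V ∈ Δ) (hVs : star S V = V) {u : L} (hu : u ∈ M)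
    (huV : Moves Δ V u V) (hup : IsPElement p u) :
    ∃ g ∈ M, ∃ W, Moves Δ V g W ∧ conj u g ∈ S := by
  obtain ⟨K, hK⟩ := hS.exists_rank_le hf
  have hSp : ∀ x ∈ S, IsPElement p x := hmax.prop.pow_eq_one
  induction hd : K - rank S V using Nat.strong_induction_on generalizing V u with
  | _ d ih =>
  subst hd
  have hT := hS.isSubgroup_top
  have hNS : ∀ W : Set L, {s | s ∈ S ∧ Moves Δ W s W} ⊆ S := fun W s hs => hs.1
  -- Among the objects W to which elements of M conjugate V, take one whose normalizer N in S has
  -- maximal rank.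
  have hex : ∃ n, ∃ g ∈ M, ∃ W, Moves Δ V g W ∧ K - rank S {s | s ∈ S ∧ Moves Δ W s W} = n :=
    ⟨_, one L, hM.one_mem, V, hS.moves_one hV, rfl⟩
  classical
  obtain ⟨g, hg, W, hgW, hn⟩ := Nat.find_spec hex
  have hmin : ∀ c ∈ M, ∀ W', Moves Δ W c W' →
      rank S {s | s ∈ S ∧ Moves Δ W' s W'} ≤ rank S {s | s ∈ S ∧ Moves Δ W s W} := by
    intro c hc W' hW'
    have h1 := Nat.find_min' hex ⟨mul g c, hM.mul_mem hg hc (hS.pair_mem hgW hW'), W',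
      hS.moves_mul hgW hW', rfl⟩
    have h2 := hK _ (hNS W')
    omega
  clear hn hex
  set N : Set L := {s | s ∈ S ∧ Moves Δ W s W} with hN
  have hWΔ := hgW.right_mem
  have hWS := hS.subset_top W hWΔ
  have hWN : W ⊆ N := fun s hs => ⟨hWS hs, hS.moves_self hWΔ hs⟩
  have hVc := hS.subset_conjInto hgW
  have hWeq := hgW.conjEq.eq
  have hWs : star S W = W := by rw [hWeq, star_conjSet hVc, hVs]
  have hWr : rank S W = rank S V := by rw [hWeq, hS.rank_conjSet hf hVc]
  have hBS : star S N ⊆ S := star_subset (hNS W)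
  have hWB : W ⊆ star S N := hWN.trans (subset_star N)
  have hBΔ : star S N ∈ Δ := hS.mem_of_subset hWΔ hWB hBS (hS.isSubgroup_star (hNS W))
  -- In the group of all elements normalizing S, such a y generates a p-subgroup with S, which is S
  -- by maximality.
  have hmem_S : ∀ y, IsPElement p y → Moves Δ S y S → y ∈ S := by
    intro y hyp hy
    have h1 := hS.isSubgroup_normalizer (M := Set.univ)
      ⟨⟨y, trivial⟩, fun _ _ => trivial, fun _ _ _ => trivial⟩ hS.top_mem
    obtain ⟨B, hB, hSB, hyB⟩ := h1.exists_pSubgroup hp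
      (fun s hs => ⟨trivial, hS.moves_self hS.top_mem hs⟩) hmax.prop
      (fun a ha g hg => hg.2.conjEq.mem ha) ⟨trivial, hy⟩ hyp
    exact hmax.le_of_ge hB hSB hyB
  have key : ∀ y ∈ M, IsPElement p y → Moves Δ W y W → Moves Δ (star S N) y (star S N) →
      y ∈ S := by
    intro y hyM hyp hyW hyB
    by_cases hBW : star S N ⊆ W
    -- If N^⋆ ⊆ W, the normalizer of W in S does not grow, which forces W = S.
    · have hSW : S ⊆ W := by
        by_contra hne
        obtain ⟨z, hzS, hzW, hz⟩ := hS.exists_moves_notMem hf hp hSp hlf hWΔ hWs hT subset_rfl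
          hWS hne
        exact hzW (hBW (subset_star N ⟨hzS, hz⟩))
      obtain rfl := Set.Subset.antisymm hWS hSW
      exact hmem_S y hyp hyW
    have hlt : rank S V < rank S (star S N) := by
      rw [← hWr]
      by_contra hle
      have := hS.star_eq_of_rank_le hf hWS hBS (star_mono hWB) (not_lt.1 hle)
      rw [hWs, star_star] at this
      exact hBW this.ge
    -- N^⋆ has larger rank than V, so induction applies to it. Since N^c normalizes W^c, the choice
    -- of W makes N^c and the normalizer of W^c in S have the same closure. That closure contains
    -- y^c, so y ∈ N^⋆.
    obtain ⟨c, hc, B', hcB, hyc⟩ := ih (K - rank S (star S N))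
      (by have := hK _ hBS; omega) hBΔ (star_star N) hyM hyB hyp rfl
    have hBc := hS.subset_conjInto hcB
    have hcW := hS.moves_conjSet hWΔ (hWB.trans hBc)
    have hNc : N ⊆ conjInto S [c] := (subset_star N).trans hBc
    have h1 : conjSet N c ⊆ {s | s ∈ S ∧ Moves Δ (conjSet W c) s (conjSet W c)} := by
      rintro _ ⟨s, hs, rfl⟩
      exact ⟨(hNc hs).2.2, hS.moves_conj hcW hs.2⟩
    have h2 := hmin c hc _ hcW
    rw [← hS.rank_conjSet hf hNc] at h2
    have h3 := hS.star_eq_of_rank_le hf (h1.trans (hNS _)) (hNS _) (star_mono h1) h2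
    have h4 : conj y c ∈ star S (conjSet N c) := by
      rw [h3]
      exact subset_star _ ⟨hyc, hS.moves_conj hcW hyW⟩
    rw [star_conjSet hNc] at h4
    obtain ⟨z, hz, hzy⟩ := h4
    have h5 : z = y := conj_injOn c (hcB.conjEq.1 hz) (hS.mem_conjDom_of_moves hcB hyB) hzy
    exact hBS (h5 ▸ hz)
  have hG := hS.isSubgroup_normalizer hM hWΔ
  obtain ⟨F, hF, hFN, hFs⟩ := hS.exists_finite_star_eq hf (hNS W)
  have hu' : conj u g ∈ {g | g ∈ M ∧ Moves Δ W g W} :=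
    ⟨hM.prod_mem _ (by simp [hM.inv_mem _ hg, hu, hg]) (hS.mem_conjDom_of_moves hgW huV),
      hS.moves_conj hgW huV⟩
  obtain ⟨Q, hQ, hQfin, hFQ, hQG⟩ := hlf _ hG (insert (conj u g) F) (hF.insert _)
    (Set.insert_subset hu' fun s hs => ⟨hSM (hFN hs).1, (hFN hs).2⟩)
  have hAN : Q ∩ S ⊆ N := fun a ha => ⟨ha.2, (hQG ha.1).2⟩
  have hAs : star S (Q ∩ S) = star S N := by
    refine Set.Subset.antisymm (star_mono hAN) ?_
    rw [← hFs]
    exact star_mono fun s hs => ⟨hFQ (Set.mem_insert_of_mem _ hs), (hFN hs).1⟩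
  -- A p-element of Q normalizing Q ∩ S normalizes its closure N^⋆, hence lies in S by `key`. So Q ∩
  -- S is a Sylow subgroup of the finite group Q.
  obtain ⟨c, hcQ, hc⟩ := hQ.exists_conj_mem hp hQfin (hQ.inter hT) Set.inter_subset_left
    (fun a ha => hSp a ha.2) (fun y hyQ hyp hy => ⟨hyQ, by
      refine key y (hQG hyQ).1 hyp (hQG hyQ).2 ?_
      have := hS.moves_star (A := Q ∩ S) hf (hAs ▸ hBΔ) Set.inter_subset_right fun a ha =>
        ⟨hQ.mem_conjDom ha.1 hyQ, hy a ha⟩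
      rwa [hAs] at this⟩) (hFQ (Set.mem_insert _ F))
      (hS.isPElement_conj hgW huV hup)
  obtain ⟨hcM, hcW⟩ := hQG hcQ
  refine ⟨mul g c, hM.mul_mem hg hcM (hS.pair_mem hgW hcW), W, hS.moves_mul hgW hcW, ?_⟩
  rw [(hS.conj_mul_of_moves hgW hcW huV).2]
  exact hc.2

end IsPreLocality

end Sylow

end PartialGroup

namespace PartialGroup

/-! ### Projections: large lifts, saturation of H, and lifting of conjugates. -/

section Projection

variable {L : Type u} {L' : Type v} [PartialGroup L] [PartialGroup L'] {β : L → L'}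

namespace IsHom

variable (hβ : IsHom β)
include hβ

theorem map_one : β (one L) = one L' := hβ.map_prod [] nil_mem

theorem map_mul {a b : L} (h : [a, b] ∈ D) : β (mul a b) = mul (β a) (β b) := hβ.map_prod _ h

theorem map_inv (x : L) : β (inv x) = inv (β x) := by
  have h : [inv x, x] ∈ D := invWord_append_mem (w := [x]) (singleton_mem x)
  refine eq_inv_of_mul_eq_one (hβ.map_mem _ h) ?_
  rw [← hβ.map_mul h, inv_mul_self, hβ.map_one]

theorem map_conj {x g : L} (h : x ∈ conjDom g) :
    β x ∈ conjDom (β g) ∧ β (conj x g) = conj (β x) (β g) := by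
  have h1 := hβ.map_mem _ h
  have h2 := hβ.map_prod _ h
  simp only [List.map_cons, List.map_nil, hβ.map_inv] at h1 h2
  exact ⟨h1, h2⟩

theorem isPartialSubgroup_preimage {K : Set L'} (hK : IsPartialSubgroup K) :
    IsPartialSubgroup (β ⁻¹' K) := by
  refine ⟨⟨one L, ?_⟩, fun x hx => ?_, fun w hw hD => ?_⟩
  · rw [Set.mem_preimage, hβ.map_one]; exact hK.one_mem
  · rw [Set.mem_preimage, hβ.map_inv]; exact hK.inv_mem _ hx
  · rw [Set.mem_preimage, hβ.map_prod w hD]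
    refine hK.prod_mem _ ?_ (hβ.map_mem w hD)
    simpa using hw

theorem isSubgroup_inter_preimage {S : Set L} (hS : IsSubgroup S) {K : Set L'}
    (hK : IsPartialSubgroup K) : IsSubgroup (S ∩ β ⁻¹' K) := by
  have h := hβ.isPartialSubgroup_preimage hK
  exact hS.of_subset Set.inter_subset_left ⟨one L, hS.one_mem, h.one_mem⟩
    (fun a ha b hb => ⟨hS.mul_mem ha.1 hb.1, h.mul_mem ha.2 hb.2 (hS.pair_mem ha.1 hb.1)⟩)
    fun a ha => ⟨hS.inv_mem ha.1, h.inv_mem a ha.2⟩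

end IsHom

namespace IsProjection

variable {Δ : Set (Set L)} {S : Set L} {Δ' : Set (Set L')} {S' : Set L'}

theorem exists_word (hβ : IsProjection Δ Δ' β) {w' : List L'} (h : w' ∈ D) :
    ∃ w ∈ D, w.map β = w' := by
  rwa [← hβ.image_D] at h

theorem surjective (hβ : IsProjection Δ Δ' β) : Function.Surjective β := by
  intro g'
  obtain ⟨w, -, hw⟩ := hβ.exists_word (singleton_mem g')
  obtain ⟨x, -, hx⟩ : ∃ x ∈ w, β x = g' := List.mem_map.1 (by rw [hw]; simp)
  exact ⟨x, hx⟩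

theorem map_mem_top (hβ : IsProjection Δ Δ' β) (hS : IsPreLocality Δ S)
    (hS' : IsPreLocality Δ' S') {x : L} (hx : x ∈ S) : β x ∈ S' := by
  have h : β '' S ∈ Δ' := by rw [hβ.image_objects]; exact ⟨S, hS.top_mem, rfl⟩
  exact hS'.subset_top _ h ⟨x, hx, rfl⟩

theorem preimage_mem (hβ : IsProjection Δ Δ' β) (hS : IsPreLocality Δ S)
    (hS' : IsPreLocality Δ' S') {P' : Set L'} (hP' : P' ∈ Δ') : S ∩ β ⁻¹' P' ∈ Δ := by
  have h := hP'
  rw [hβ.image_objects] at h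
  obtain ⟨P, hP, rfl⟩ := h
  exact hS.mem_of_subset hP (fun x hx => ⟨hS.subset_top P hP hx, x, hx, rfl⟩)
    Set.inter_subset_left
    (hβ.isHom.isSubgroup_inter_preimage hS.isSubgroup_top (hS'.isSubgroup hP').isPartialSubgroup)

theorem exists_mem_top (hβ : IsProjection Δ Δ' β) (hS : IsPreLocality Δ S)
    (hS' : IsPreLocality Δ' S') {x' : L'} (hx : x' ∈ S') : ∃ x ∈ S, β x = x' := by
  have h := hS'.top_mem
  rw [hβ.image_objects] at h
  obtain ⟨P, hP, rfl⟩ := h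
  obtain ⟨x, hx, rfl⟩ := hx
  exact ⟨x, hS.subset_top P hP hx, rfl⟩

theorem map_mem_conjInto (hβ : IsProjection Δ Δ' β) (hS : IsPreLocality Δ S)
    (hS' : IsPreLocality Δ' S') {x g : L} (hx : x ∈ conjInto S [g]) :
    β x ∈ conjInto S' [β g] := by
  obtain ⟨h1, h2⟩ := hβ.isHom.map_conj hx.2.1
  exact ⟨hβ.map_mem_top hS hS' hx.1, h1, by
    change conj (β x) (β g) ∈ S'
    rw [← h2]; exact hβ.map_mem_top hS hS' hx.2.2⟩

/-- Every element of the image has a preimage `f` for which `S_f` is as large as it can be. -/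
theorem exists_lift (hβ : IsProjection Δ Δ' β) (hL : IsLocality Δ S) (hS' : IsPreLocality Δ' S')
    (g' : L') : ∃ f, β f = g' ∧ ∀ x ∈ S, β x ∈ conjInto S' [g'] → x ∈ conjInto S [f] := by
  have hS := hL.isPreLocality
  have hf := hL.finiteDim
  obtain ⟨p, hp, hmax⟩ := hL.maximal_pSubgroup
  have hSp : ∀ x ∈ S, IsPElement p x := hmax.prop.pow_eq_one
  obtain ⟨K, hK⟩ := hS.exists_rank_le hf
  -- Choose a lift h for which the rank of S_h is maximal.
  have hex : ∃ n, ∃ h, β h = g' ∧ K - rank S (conjInto S [h]) = n :=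
    let ⟨h, hh⟩ := hβ.surjective g'; ⟨_, h, hh, rfl⟩
  classical
  obtain ⟨h, rfl, hn⟩ := Nat.find_spec hex
  refine ⟨h, rfl, ?_⟩
  by_contra! hne
  obtain ⟨x, hxS, hx', hx⟩ := hne
  have hT := hS.isSubgroup_top
  have hP := hβ.isHom.isSubgroup_inter_preimage hT
    (hS'.isSubgroup_conjInto [β h]).isPartialSubgroup
  have hRP : conjInto S [h] ⊆ S ∩ β ⁻¹' conjInto S' [β h] :=
    fun y hy => ⟨hy.1, hβ.map_mem_conjInto hS hS' hy⟩
  obtain ⟨y, hyP, hyR, hyN⟩ := hS.exists_moves_notMem hf hp hSp hL.locallyFinite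
    (hS.conjInto_mem h) (star_conjInto [h]) hP Set.inter_subset_left hRP
    fun hPR => hx (hPR ⟨hxS, hx'⟩)
  have hh := hS.moves_conjSet (hS.conjInto_mem h) subset_rfl
  have hVs : star S (conjSet (conjInto S [h]) h) = conjSet (conjInto S [h]) h := by
    rw [star_conjSet subset_rfl, star_conjInto]
  have hyd := hS.mem_conjDom_of_moves hh hyN
  obtain ⟨g, hg, W, hgW, hyg⟩ := hS.exists_moves_conj_mem hf hp hmax hL.locallyFinite
    (hβ.isHom.isPartialSubgroup_preimage hS'.isSubgroup_top.isPartialSubgroup)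
    (fun s hs => hβ.map_mem_top hS hS' hs) hh.right_mem hVs (u := conj y h)
    (by rw [Set.mem_preimage, (hβ.isHom.map_conj hyd).2]; exact hyP.2.2.2)
    (hS.moves_conj hh hyN) (hS.isPElement_conj hh hyN (hSp y hyP.1))
  -- Multiplying by s⁻¹ corrects the image: h g moves y into S but lies over g' β(g), and h g s⁻¹
  -- lies over g' again.
  obtain ⟨s, hs, hsg⟩ := hβ.exists_mem_top hS hS' hg
  have hsW := hS.moves_conjSet_of_mem hgW.right_mem (hT.inv_mem hs)
  have h1 := hS.moves_mul hh hgW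
  have h2 := hS.moves_mul h1 hsW
  have hβf : β (mul (mul h g) (inv s)) = β h := by
    have h3 : [β h, β g] ∈ D := hβ.isHom.map_mem _ (hS.pair_mem hh hgW)
    have h4 : [β h, β g, inv (β g)] ∈ D := append_append_invWord_mem (u := [β h]) h3
    rw [hβ.isHom.map_mul (hS.pair_mem h1 hsW), hβ.isHom.map_mul (hS.pair_mem hh hgW),
      hβ.isHom.map_inv, hsg, mul_mul_eq h4, mul_inv_self, mul_one_eq]
  obtain ⟨h5, h6⟩ := hS.conj_mul_of_moves h1 hsW hyN
  have hyf : y ∈ conjInto S [mul (mul h g) (inv s)] := by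
    refine ⟨hyP.1, h5, ?_⟩
    change conj y (mul (mul h g) (inv s)) ∈ S
    rw [h6, (hS.conj_mul_of_moves hh hgW hyN).2]
    exact hT.conj_mem hyg (hT.inv_mem hs)
  have h7 := Nat.find_min' hex ⟨_, hβf, rfl⟩
  have h8 := hS.subset_conjInto h2
  have h9 := hK _ (conjInto_subset (S := S) [h])
  have h10 := hK _ (conjInto_subset (S := S) [mul (mul h g) (inv s)])
  have h11 := hS.star_eq_of_rank_le hf (conjInto_subset _) (conjInto_subset _) (star_mono h8)
    (by omega)
  rw [star_conjInto, star_conjInto] at h11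
  exact hyR (h11 ▸ hyf)

/-- S_g ⊆ S_f, so both elements conjugate S_g to objects. This makes the quotients g⁻¹f and f⁻¹g
defined; they lie in the kernel, hence in H. -/
theorem mem_iff_of_lift (hβ : IsProjection Δ Δ' β) (hS : IsPreLocality Δ S)
    (hS' : IsPreLocality Δ' S') {f g : L} (hfg : β f = β g)
    (hf : ∀ x ∈ S, β x ∈ conjInto S' [β g] → x ∈ conjInto S [f]) {H : Set L}
    (hH : IsPartialSubgroup H) (hker : ker β ⊆ H) : f ∈ H ↔ g ∈ H := by
  have hg := hS.moves_conjSet (hS.conjInto_mem g) subset_rfl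
  have hgf := hS.moves_conjSet (g := f) (hS.conjInto_mem g)
    fun x hx => hf x hx.1 (hβ.map_mem_conjInto hS hS' hx)
  have key : ∀ {a b : L} {X Y Z : Set L}, Moves Δ X a Y → Moves Δ X b Z → β a = β b →
      a ∈ H → b ∈ H := by
    intro a b X Y Z ha hb hab haH
    have h1 := hS.pair_mem ha.symm hb
    have h2 : mul (inv a) b ∈ ker β := by
      change β _ = _
      rw [hβ.isHom.map_mul h1, hβ.isHom.map_inv, hab, inv_mul_self]
    have h3 := hS.moves_mul ha.symm hb
    have h4 : mul a (mul (inv a) b) = b := by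
      have h5 : [a, inv a, b] ∈ D :=
        hS.mem_D (ha.chain_cons (ha.symm.chain_cons (hb.chain_cons hb.right_mem)))
      rw [← mul_mul_eq h5, mul_inv_self, one_mul_eq]
    rw [← h4]
    exact hH.mul_mem haH (hker h2) (hS.pair_mem ha h3)
  exact ⟨key hgf hg hfg, key hg hgf hfg.symm⟩

/-- g and h need not have a common object to conjugate, so each is compared with one large lift of
their common image. -/
theorem mem_of_map_eq (hβ : IsProjection Δ Δ' β) (hL : IsLocality Δ S)
    (hS' : IsPreLocality Δ' S') {H : Set L} (hH : IsPartialSubgroup H) (hker : ker β ⊆ H)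
    {g h : L} (hh : h ∈ H) (hgh : β g = β h) : g ∈ H := by
  obtain ⟨f, hfh, hf⟩ := hβ.exists_lift hL hS' (β h)
  exact (hβ.mem_iff_of_lift hL.isPreLocality hS' (hfh.trans hgh.symm) (hgh ▸ hf) hH hker).1
    ((hβ.mem_iff_of_lift hL.isPreLocality hS' hfh hf hH hker).2 hh)

theorem preimage_image (hβ : IsProjection Δ Δ' β) (hL : IsLocality Δ S)
    (hS' : IsPreLocality Δ' S') {H : Set L} (hH : IsPartialSubgroup H) (hker : ker β ⊆ H) :
    β ⁻¹' (β '' H) = H := by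
  refine Set.Subset.antisymm ?_ (Set.subset_preimage_image β H)
  rintro g ⟨h, hh, e⟩
  exact hβ.mem_of_map_eq hL hS' hH hker hh e.symm

theorem isPartialSubgroup_image (hβ : IsProjection Δ Δ' β) (hL : IsLocality Δ S)
    (hS' : IsPreLocality Δ' S') {H : Set L} (hH : IsPartialSubgroup H) (hker : ker β ⊆ H) :
    IsPartialSubgroup (β '' H) := by
  refine ⟨hH.nonempty.image β, ?_, fun w' hw' hD => ?_⟩
  · rintro _ ⟨x, hx, rfl⟩
    exact ⟨inv x, hH.inv_mem x hx, hβ.isHom.map_inv x⟩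
  · obtain ⟨w, hw, rfl⟩ := hβ.exists_word hD
    refine ⟨prod w, hH.prod_mem w (fun x hx => ?_) hw, hβ.isHom.map_prod w hw⟩
    rw [← hβ.preimage_image hL hS' hH hker]
    -- The letters of an arbitrary lifted word lie in H because H is a full preimage.
    exact hw' _ (List.mem_map_of_mem hx)

/-- If a conjugate is defined in the image, so is the conjugate of suitable preimages. -/
theorem exists_mem_conjDom (hβ : IsProjection Δ Δ' β) (hL : IsLocality Δ S)
    (hS' : IsPreLocality Δ' S') {x' g' : L'} (h : x' ∈ conjDom g') :
    ∃ x g, β x = x' ∧ β g = g' ∧ x ∈ conjDom g := by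
  have hS := hL.isPreLocality
  -- Lifting the word (g'⁻¹, x', g') letter by letter in `D` would not make the outer letters
  -- mutually inverse. Large lifts of x' and g' can instead be followed along preimages of the
  -- objects in the image.
  obtain ⟨x, hx, hxl⟩ := hβ.exists_lift hL hS' x'
  obtain ⟨g, hg, hgl⟩ := hβ.exists_lift hL hS' g'
  obtain ⟨P0, hP0⟩ := hS'.exists_chain h
  obtain ⟨P1, h1, hP1⟩ := hP0.exists_moves
  obtain ⟨P2, h2, hP2⟩ := hP1.exists_moves
  obtain ⟨P3, h3, -⟩ := hP2.exists_moves
  have hP := hβ.preimage_mem hS hS' h1.right_mem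
  have m1 := hS.moves_conjSet hP fun y hy => hgl y hy.1 (hS'.subset_conjInto h1.of_inv hy.2)
  have m2 := hS.moves_conjSet hP fun y hy => hxl y hy.1 (hS'.subset_conjInto h2 hy.2)
  have m3 := hS.moves_conjSet (g := g) m2.right_mem <| by
    rintro _ ⟨y, hy, rfl⟩
    refine hgl _ (hxl y hy.1 (hS'.subset_conjInto h2 hy.2)).2.2 (hS'.subset_conjInto h3 ?_)
    change β (conj y x) ∈ P2
    rw [(hβ.isHom.map_conj (m2.conjEq.1 hy)).2, hx]
    exact h2.conjEq.mem hy.2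
  exact ⟨x, g, hx, hg, hS.mem_D (m1.symm.chain_cons (m2.chain_cons (m3.chain_cons m3.right_mem)))⟩

end IsProjection

end Projection

end PartialGroup

theorem proposition5p7 {L : Type u} {L' : Type v} [PartialGroup L] [PartialGroup L']
    (Δ : Set (Set L)) (S : Set L) (Δ' : Set (Set L')) (S' : Set L')
    (hL : PartialGroup.IsLocality Δ S) (hL' : PartialGroup.IsLocality Δ' S')
    (β : L → L') (hβ : PartialGroup.IsProjection Δ Δ' β) :
    Set.BijOn (fun H : Set L => β '' H)
        {H | PartialGroup.IsPartialSubgroup H ∧ PartialGroup.ker β ⊆ H}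
        {K | PartialGroup.IsPartialSubgroup K} ∧
      ∀ H : Set L, PartialGroup.IsPartialSubgroup H → PartialGroup.ker β ⊆ H →
        (PartialGroup.IsPartialNormal (β '' H) ↔ PartialGroup.IsPartialNormal H) := by
  have hS' := hL'.isPreLocality
  refine ⟨⟨?_, ?_, ?_⟩, ?_⟩
  · rintro H ⟨hH, hker⟩
    exact hβ.isPartialSubgroup_image hL hS' hH hker
  · rintro H ⟨hH, hkH⟩ K ⟨hK, hkK⟩ e
    simp only at e
    rw [← hβ.preimage_image hL hS' hH hkH, e, hβ.preimage_image hL hS' hK hkK]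
  · intro K hK
    refine ⟨β ⁻¹' K, ⟨hβ.isHom.isPartialSubgroup_preimage hK, fun x hx => ?_⟩,
      Set.image_preimage_eq K hβ.surjective⟩
    rw [Set.mem_preimage, show β x = PartialGroup.one L' from hx]
    exact hK.one_mem
  · intro H hH hker
    have hpre := hβ.preimage_image hL hS' hH hker
    constructor
    · refine fun hN => ⟨hH, fun x hx g hxg => ?_⟩
      obtain ⟨h1, h2⟩ := hβ.isHom.map_conj hxg
      rw [← hpre, Set.mem_preimage, h2]
      exact hN.conj_mem _ ⟨x, hx, rfl⟩ _ h1
    · refine fun hN => ⟨hβ.isPartialSubgroup_image hL hS' hH hker, fun x' hx' g' h => ?_⟩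
      obtain ⟨x, g, rfl, rfl, hxg⟩ := hβ.exists_mem_conjDom hL hS' h
      rw [← (hβ.isHom.map_conj hxg).2]
      refine ⟨_, hN.conj_mem x ?_ g hxg, rfl⟩
      rw [← hpre]
      exact hx'
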